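/- \textbf{Theorem (Perron method).} Let $n\ge 1$, let $\Omega\subset\mathbb C^n$ be a bounded domain, let $f:\overline\Omega\to\mathbb R$ be continuous and positive, and let $\mathbb H^n$ be the space of Hermitian $n\times n$ matrices, $\Lambda_1(A)$ the smallest eigenvalue of $A\in\mathbb H^n$, and $\mathcal C_n=\{P\in\mathbb H^n: P>0\}$. Let $\mathcal C\subset\mathbb H^n$ and $G:\overline{\mathcal C}\to\mathbb R$ satisfy: a) $\mathcal C$ is a nonempty open cone in $\mathbb H^n$ and $\mathcal C_n\subset\mathcal C$; b) $G$ is continuous on $\overline{\mathcal C}$ and $G\ge 0$ on $\mathcal C$; c) there is a constant $C>0$ such that for all $A\in\mathcal C$ and $P\in\mathcal C_n$ one has $A+P\in\overline{\mathcal C}$ and $G(A+P)-G(A)\ge C\Lambda_1(P)$. Assume moreover that $G(A)\le f(z)$ for all $A\in\overline{\mathcal C}\setminus\mathcal C$ and $z\in\Omega$ (automatic if $G=0$ on $\partial\mathcal C$). Write $D^2_{\mathbb C}\psi=\left(\partial^2\psi/\partial z_j\partial\bar z_k\right)_{j,k}$. An upper semicontinuous $u:\Omega\to[-\infty,\infty)$,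 $u\not\equiv-\infty$, is a (viscosity) subsolution of $G(D^2_{\mathbb C}u)=f$ if, whenever $z_0\in\Omega$ and $\psi$ is $C^2$ near $z_0$ with $\psi(z_0)=u(z_0)$ and $\psi\ge u$ near $z_0$, one has $D^2_{\mathbb C}\psi(z_0)\in\overline{\mathcal C}$ and $G(D^2_{\mathbb C}\psi(z_0))\ge f(z_0)$. A lower semicontinuous $u:\Omega\to(-\infty,\infty]$, $u\not\equiv+\infty$, is a (viscosity) supersolution if, whenever $z_0\in\Omega$ and $\psi$ is $C^2$ near $z_0$ with $\psi(z_0)=u(z_0)$, $\psi\le u$ near $z_0$ and $D^2_{\mathbb C}\psi(z_0)\in\overline{\mathcal C}$, one has $G(D^2_{\mathbb C}\psi(z_0))\le f(z_0)$. A viscosity solution is a function $u:\Omega\to\mathbb R$ that is both. For $\zeta\in\partial\Omega$ put $u^*(\zeta)=\inf_{r>0}\sup_{\mathbb B(\zeta,r)\cap\Omega}u$ and $u_*(\zeta)=\sup_{r>0}\inf_{\mathbb B(\zeta,r)\cap\Omega}u$. Let $\varphi:\partial\Omega\to\mathbb R$ be continuous, and let $\underline\phi$ be a subsolution and $\overline\phi$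 a supersolution of $G(D^2_{\mathbb C}u)=f$ in $\Omega$ with $\underline\phi\le\overline\phi$ in $\Omega$ and $$\underline\phi_*=\overline\phi^*=\varphi\quad\text{on }\partial\Omega .$$ Then $$u(z)=\sup\{v(z):\ v:\Omega\to\mathbb R\text{ bounded, upper semicontinuous, a subsolution of }G(D^2_{\mathbb C}u)=f,\ \underline\phi\le v\le\overline\phi\text{ in }\Omega\}$$ is finite for every $z\in\Omega$, it is a viscosity solution of $G(D^2_{\mathbb C}u)=f$ in $\Omega$ with $\lim_{\Omega\ni z\to\zeta}u(z)=\varphi(\zeta)$ for every $\zeta\in\partial\Omega$, and it is the only viscosity solution with these boundary values. -/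

import Mathlib

open Set Filter Topology
open scoped ComplexOrder

noncomputable section

/-- The space `ℂⁿ` with its Euclidean norm. -/
abbrev Cn (n : ℕ) : Type := EuclideanSpace ℂ (Fin n)

/-- The complex Hessian `D²_ℂ ψ (z) = (∂²ψ / ∂z_j ∂z̄_k)_{j,k}` of a real function `ψ` on `ℂⁿ`.
With `B = D²ψ(z)` the real second derivative, `∂/∂z_j = (∂/∂x_j - i ∂/∂y_j) / 2` and
`∂/∂z̄_k = (∂/∂x_k + i ∂/∂y_k) / 2`, the `(j,k)` entry is
`(B(e_j, e_k) + B(i e_j, i e_k) + i (B(e_j, i e_k) - B(i e_j, e_k))) / 4`. -/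
def complexHessian {n : ℕ} (ψ : Cn n → ℝ) (z : Cn n) : Matrix (Fin n) (Fin n) ℂ :=
  Matrix.of fun j k =>
    let B : Cn n → Cn n → ℝ := fun v w => fderiv ℝ (fderiv ℝ ψ) z v w
    let e : Fin n → Cn n := fun l => EuclideanSpace.single l (1 : ℂ)
    let ie : Fin n → Cn n := fun l => EuclideanSpace.single l Complex.I
    (((B (e j) (e k) + B (ie j) (ie k) : ℝ) : ℂ)
      + Complex.I * ((B (e j) (ie k) - B (ie j) (e k) : ℝ) : ℂ)) / 4

/-- The smallest eigenvalue `Λ₁(A)` of a Hermitian matrix. -/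
def leastEigenvalue {n : ℕ} (A : Matrix (Fin n) (Fin n) ℂ) (hA : A.IsHermitian) : ℝ :=
  ⨅ i, hA.eigenvalues i

/-- The upper semicontinuous envelope `u^*(z) = inf_{r > 0} sup {u(y) : y ∈ B(z,r) ∩ Ω}` of a
function on `Ω`; it is used at points of the closure of `Ω`. -/
def upperEnvelope {n : ℕ} (Ω : Set (Cn n)) (u : Cn n → EReal) (z : Cn n) : EReal :=
  ⨅ r : ℝ, ⨅ _ : 0 < r, ⨆ y ∈ Metric.ball z r ∩ Ω, u y

/-- The lower semicontinuous envelope `u_*(z) = sup_{r > 0} inf {u(y) : y ∈ B(z,r) ∩ Ω}` of a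
function on `Ω`; it is used at points of the closure of `Ω`. -/
def lowerEnvelope {n : ℕ} (Ω : Set (Cn n)) (u : Cn n → EReal) (z : Cn n) : EReal :=
  ⨆ r : ℝ, ⨆ _ : 0 < r, ⨅ y ∈ Metric.ball z r ∩ Ω, u y

/-- `ψ`, of class `C²` in a neighbourhood of `z₀`, touches `u` from above at `z₀`. -/
def TouchesFromAbove {n : ℕ} (ψ : Cn n → ℝ) (u : Cn n → EReal) (z₀ : Cn n) : Prop :=
  ContDiffAt ℝ 2 ψ z₀ ∧ (ψ z₀ : EReal) = u z₀ ∧ ∀ᶠ z in 𝓝 z₀, u z ≤ (ψ z : EReal)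

/-- `ψ`, of class `C²` in a neighbourhood of `z₀`, touches `u` from below at `z₀`. -/
def TouchesFromBelow {n : ℕ} (ψ : Cn n → ℝ) (u : Cn n → EReal) (z₀ : Cn n) : Prop :=
  ContDiffAt ℝ 2 ψ z₀ ∧ (ψ z₀ : EReal) = u z₀ ∧ ∀ᶠ z in 𝓝 z₀, (ψ z : EReal) ≤ u z

/-- The structural assumptions on the operator `G : 𝒞 → [0, ∞)`, where `𝒞` is a set of Hermitian
matrices and `G` is extended continuously to the closure of `𝒞`.  Values of `G` outside the closure
of `𝒞` are never used. -/
structure IsAdmissibleOperator {n : ℕ} (𝒞 : Set (Matrix (Fin n) (Fin n) ℂ))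
    (G : Matrix (Fin n) (Fin n) ℂ → ℝ) : Prop where
  /-- `𝒞` is a relatively open subset of the space of Hermitian matrices. -/
  isOpen : ∃ U : Set (Matrix (Fin n) (Fin n) ℂ), IsOpen U ∧ 𝒞 = U ∩ {A | A.IsHermitian}
  nonempty : 𝒞.Nonempty
  /-- `𝒞` is a cone. -/
  smul_mem : ∀ A ∈ 𝒞, ∀ t : ℝ, 0 < t → (t : ℂ) • A ∈ 𝒞
  posDef_mem : ∀ P : Matrix (Fin n) (Fin n) ℂ, P.PosDef → P ∈ 𝒞
  continuousOn : ContinuousOn G (closure 𝒞)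
  nonneg : ∀ A ∈ 𝒞, 0 ≤ G A
  /-- `G(A + P) - G(A) ≥ C Λ₁(P)`, with `A + P` in the domain of `G`. -/
  comparison : ∃ C : ℝ, 0 < C ∧ ∀ A ∈ 𝒞, ∀ P : Matrix (Fin n) (Fin n) ℂ, ∀ hP : P.PosDef,
    A + P ∈ closure 𝒞 ∧ C * leastEigenvalue P hP.isHermitian ≤ G (A + P) - G A

/-- `u : Ω → [-∞, ∞)` is a viscosity subsolution of `G(D²_ℂ u) = f` in `Ω`.  The inequality
`G(D²_ℂ ψ) ≥ f` includes that `D²_ℂ ψ` lies in the domain `closure 𝒞` of `G`. -/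
structure IsViscositySubsolution {n : ℕ} (𝒞 : Set (Matrix (Fin n) (Fin n) ℂ))
    (G : Matrix (Fin n) (Fin n) ℂ → ℝ) (f : Cn n → ℝ) (Ω : Set (Cn n))
    (u : Cn n → EReal) : Prop where
  upperSemicontinuousOn : UpperSemicontinuousOn u Ω
  lt_top : ∀ z ∈ Ω, u z < ⊤
  proper : ∃ z ∈ Ω, u z ≠ ⊥
  le_operator : ∀ z₀ ∈ Ω, ∀ ψ : Cn n → ℝ, TouchesFromAbove ψ u z₀ →
    complexHessian ψ z₀ ∈ closure 𝒞 ∧ f z₀ ≤ G (complexHessian ψ z₀)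

/-- `u : Ω → (-∞, ∞]` is a viscosity supersolution of `G(D²_ℂ u) = f` in `Ω`. -/
structure IsViscositySupersolution {n : ℕ} (𝒞 : Set (Matrix (Fin n) (Fin n) ℂ))
    (G : Matrix (Fin n) (Fin n) ℂ → ℝ) (f : Cn n → ℝ) (Ω : Set (Cn n))
    (u : Cn n → EReal) : Prop where
  lowerSemicontinuousOn : LowerSemicontinuousOn u Ω
  bot_lt : ∀ z ∈ Ω, ⊥ < u z
  proper : ∃ z ∈ Ω, u z ≠ ⊤
  operator_le : ∀ z₀ ∈ Ω, ∀ ψ : Cn n → ℝ, TouchesFromBelow ψ u z₀ →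
    complexHessian ψ z₀ ∈ closure 𝒞 → G (complexHessian ψ z₀) ≤ f z₀

/-- `u : Ω → ℝ` is a viscosity solution of `G(D²_ℂ u) = f` in `Ω`. -/
def IsViscositySolution {n : ℕ} (𝒞 : Set (Matrix (Fin n) (Fin n) ℂ))
    (G : Matrix (Fin n) (Fin n) ℂ → ℝ) (f : Cn n → ℝ) (Ω : Set (Cn n))
    (u : Cn n → ℝ) : Prop :=
  IsViscositySubsolution 𝒞 G f Ω (fun z => (u z : EReal)) ∧
    IsViscositySupersolution 𝒞 G f Ω (fun z => (u z : EReal))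

/-- The bounded upper semicontinuous subsolutions `v : Ω → ℝ` with `φsub ≤ v ≤ φsup` in `Ω`. -/
def perronFamily {n : ℕ} (𝒞 : Set (Matrix (Fin n) (Fin n) ℂ))
    (G : Matrix (Fin n) (Fin n) ℂ → ℝ) (f : Cn n → ℝ) (Ω : Set (Cn n))
    (φsub φsup : Cn n → EReal) : Set (Cn n → ℝ) :=
  {v | (∃ M : ℝ, ∀ z ∈ Ω, |v z| ≤ M) ∧
    IsViscositySubsolution 𝒞 G f Ω (fun z => (v z : EReal)) ∧
    ∀ z ∈ Ω, φsub z ≤ (v z : EReal) ∧ (v z : EReal) ≤ φsup z}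

/-- The pointwise supremum of the Perron family, taken in `[-∞, ∞]`. -/
def perronEnvelope {n : ℕ} (𝒞 : Set (Matrix (Fin n) (Fin n) ℂ))
    (G : Matrix (Fin n) (Fin n) ℂ → ℝ) (f : Cn n → ℝ) (Ω : Set (Cn n))
    (φsub φsup : Cn n → EReal) (z : Cn n) : EReal :=
  ⨆ v ∈ perronFamily 𝒞 G f Ω φsub φsup, (v z : EReal)

/-- `u` attains the boundary value `φ` continuously at every point of `∂Ω`. -/
def HasBoundaryValue {n : ℕ} (Ω : Set (Cn n)) (u φ : Cn n → ℝ) : Prop :=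
  ∀ ζ ∈ frontier Ω, Tendsto u (𝓝[Ω] ζ) (𝓝 (φ ζ))

end

/-! ### Slopes, Taylor expansion and concave envelopes. -/

section SecondOrder

variable {E : Type*} [NormedAddCommGroup E]

/-! Everything rests on a comparison principle: a subsolution lying below a supersolution at the
boundary lies below it inside. Granted this, Perron's argument closes. The upper envelope of the
supremum `E` is a subsolution and stays below `φsup` by comparison, so it competes in the family and
equals `E`. The lower envelope of `E` is a supersolution, since otherwise a small bump would raise
`E` within the family. Comparison puts `E` below its lower envelope, so `E` is continuous and solves
the equation; the barriers squeeze the boundary values, and comparison once more gives uniqueness.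

Comparison is proved by doubling variables. If `u > v` somewhere, replace `u` by `u + ε‖z‖²` and
maximise `u(a) + ε‖a‖² - v(b) - c/2 ‖a - b‖²`, up to a small linear term. As `c → ∞` both points
converge, along a subsequence, to one interior point. By `exists_common_hessian` the two functions
have one-sided second order expansions at `a` and `b` with the same Hessian. Raising a Hessian by `t
• 1` raises `G` by at least `C t`, so `f a + C ε / 2 ≤ f b` (`add_le_of_common_hessian`), against
the continuity of `f`. The slopes at `a` and `b` may differ, since `G` sees only Hessians.

The common Hessian needs only Rademacher's theorem. For each slope `p` the sup-convolution of `u`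
lies below the inf-convolution of `v` plus a plane of slope `p`, with contact at a point `X p`.
Between them sits one function `h`, independent of `p`: `c‖y‖²` plus the infimum of the affine
majorants given by `exists_affine_envelope`. It is semiconvex and semiconcave, hence has Lipschitz
gradient. As `p` is a Lipschitz function of `X p`, the contact points with `‖p‖ ≤ δ` are not
negligible, so `h` is twice differentiable at one of them, and its expansion passes to `u` and `v`.
-/

/-- Two points at which paraboloids and planes are mutually ordered have close slopes. -/
theorem norm_slope_sub_le [InnerProductSpace ℝ E] {k : ℝ} (hk : 0 < k) {x₁ x₂ p₁ p₂ : E}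
    {w₁ w₂ : ℝ}
    (h₁₂ : ∀ y, w₁ + inner ℝ p₁ (y - x₁) - k * ‖y - x₁‖ ^ 2 ≤ w₂ + inner ℝ p₂ (y - x₂))
    (h₂₁ : ∀ y, w₂ + inner ℝ p₂ (y - x₂) - k * ‖y - x₂‖ ^ 2 ≤ w₁ + inner ℝ p₁ (y - x₁)) :
    ‖p₁ - p₂‖ ≤ 4 * k * ‖x₁ - x₂‖ := by
  -- The test point moves from `x₂` along the difference of the slopes. This step maximises `s - 2 k
  -- s²`, so that half of the left side absorbs the quadratic error.
  set s : ℝ := 1 / (4 * k) with hs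
  have hs0 : 0 < s := by positivity
  have e₁ := h₂₁ x₂
  simp only [sub_self, inner_zero_right, norm_zero] at e₁
  have e₂ := h₁₂ (x₂ + s • (p₁ - p₂))
  have d₁ : x₂ + s • (p₁ - p₂) - x₁ = (x₂ - x₁) + s • (p₁ - p₂) := by abel
  have d₂ : x₂ + s • (p₁ - p₂) - x₂ = s • (p₁ - p₂) := by abel
  rw [d₁, d₂, inner_add_right, inner_smul_right, inner_smul_right] at e₂
  have e₃ : inner ℝ p₁ (p₁ - p₂) - inner ℝ p₂ (p₁ - p₂) = ‖p₁ - p₂‖ ^ 2 := by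
    rw [← inner_sub_left, real_inner_self_eq_norm_sq]
  have e₄ : ‖(x₂ - x₁) + s • (p₁ - p₂)‖ ^ 2 ≤ 2 * (‖x₁ - x₂‖ ^ 2 + s ^ 2 * ‖p₁ - p₂‖ ^ 2) := by
    have h := norm_add_le (x₂ - x₁) (s • (p₁ - p₂))
    rw [norm_smul, Real.norm_eq_abs, abs_of_pos hs0, norm_sub_rev] at h
    have h0 := norm_nonneg ((x₂ - x₁) + s • (p₁ - p₂))
    nlinarith [sq_nonneg (‖x₁ - x₂‖ - s * ‖p₁ - p₂‖)]
  have e₅ : s * ‖p₁ - p₂‖ ^ 2 ≤ k * (2 * (‖x₁ - x₂‖ ^ 2 + s ^ 2 * ‖p₁ - p₂‖ ^ 2)) := by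
    have := mul_le_mul_of_nonneg_left e₄ hk.le
    have e₆ : s * (inner ℝ p₁ (p₁ - p₂) - inner ℝ p₂ (p₁ - p₂)) = s * ‖p₁ - p₂‖ ^ 2 := by rw [e₃]
    linarith
  have hsk : s * k = 1 / 4 := by rw [hs]; field_simp
  refine (sq_le_sq₀ (norm_nonneg _) (by positivity)).1 ?_
  have h6 : k * (s * ‖p₁ - p₂‖ ^ 2) ≤
      k * (k * (2 * (‖x₁ - x₂‖ ^ 2 + s ^ 2 * ‖p₁ - p₂‖ ^ 2))) :=
    mul_le_mul_of_nonneg_left e₅ hk.le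
  have h7 : k * (s * ‖p₁ - p₂‖ ^ 2) = 1 / 4 * ‖p₁ - p₂‖ ^ 2 := by rw [← hsk]; ring
  have h8 : k * (k * (2 * (‖x₁ - x₂‖ ^ 2 + s ^ 2 * ‖p₁ - p₂‖ ^ 2))) =
      2 * k ^ 2 * ‖x₁ - x₂‖ ^ 2 + 2 * (s * k) ^ 2 * ‖p₁ - p₂‖ ^ 2 := by ring
  rw [h7, h8, hsk] at h6
  nlinarith

/-- Second order Taylor expansion with the Peano remainder at a point of differentiability of
the derivative. -/
theorem eventually_abs_sub_taylor_le [NormedSpace ℝ E] {g : E → ℝ} {g' : E → E →L[ℝ] ℝ}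
    {B : E →L[ℝ] E →L[ℝ] ℝ} {x : E} (hg : ∀ᶠ y in 𝓝 x, HasFDerivAt g (g' y) y)
    (hB : HasFDerivAt g' B x) {η : ℝ} (hη : 0 < η) :
    ∀ᶠ t in 𝓝 (0 : E), |g (x + t) - g x - g' x t - B t t / 2| ≤ η * ‖t‖ ^ 2 := by
  have hsymm : ∀ v w, B v w = B w v := fun v w =>
    second_derivative_symmetric_of_eventually hg hB v w
  have hB' := (hasFDerivAt_iff_isLittleO_nhds_zero.1 hB).def hη
  have hg0 : ∀ᶠ t in 𝓝 (0 : E), HasFDerivAt g (g' (x + t)) (x + t) := by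
    have : Tendsto (fun t : E => x + t) (𝓝 0) (𝓝 x) := by
      have h : Continuous fun t : E => x + t := by fun_prop
      simpa using h.tendsto 0
    exact this.eventually hg
  obtain ⟨r, hr, hball⟩ := Metric.eventually_nhds_iff_ball.1 (hB'.and hg0)
  filter_upwards [Metric.ball_mem_nhds (0 : E) hr] with t ht
  have hseg : ∀ y ∈ Metric.closedBall (0 : E) ‖t‖, y ∈ Metric.ball (0 : E) r := by
    intro y hy
    simp only [Metric.mem_closedBall, Metric.mem_ball, dist_zero_right] at *
    linarith
  -- Since `B` is symmetric, the remainder has derivative `g' (x + y) - g' x - B y`, which is at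
  -- most `η ‖t‖` on the ball of radius `‖t‖`; the mean value inequality does the rest.
  set R : E → ℝ := fun y => g (x + y) - g x - g' x y - B y y / 2 with hR
  have hder : ∀ y ∈ Metric.closedBall (0 : E) ‖t‖,
      HasFDerivWithinAt R (g' (x + y) - g' x - B y) (Metric.closedBall (0 : E) ‖t‖) y := by
    intro y hy
    have h1 : HasFDerivAt (fun y => g (x + y)) (g' (x + y)) y := by
      have h := (hball y (hseg y hy)).2
      exact (hasFDerivAt_comp_add_left x).2 h
    have h2 : HasFDerivAt (fun y => B y y) (B y + B.flip y) y := by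
      have := B.hasFDerivAt_of_bilinear (hasFDerivAt_id (𝕜 := ℝ) y) (hasFDerivAt_id (𝕜 := ℝ) y)
      refine this.congr_fderiv ?_
      ext z; simp
    have h3 := ((h1.sub_const (g x)).sub (g' x).hasFDerivAt).sub (h2.const_mul (1 / 2 : ℝ))
    refine HasFDerivAt.hasFDerivWithinAt ?_
    have h4 : R = fun y => g (x + y) - g x - g' x y - 1 / 2 * B y y := by
      funext y; simp only [hR]; ring
    rw [h4]
    refine h3.congr_fderiv ?_
    ext z
    simp only [sub_apply, smul_apply,
      add_apply, ContinuousLinearMap.flip_apply, smul_eq_mul]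
    rw [hsymm z y]; ring
  have hbound : ∀ y ∈ Metric.closedBall (0 : E) ‖t‖, ‖g' (x + y) - g' x - B y‖ ≤ η * ‖t‖ := by
    intro y hy
    refine (hball y (hseg y hy)).1.trans ?_
    have : ‖y‖ ≤ ‖t‖ := by simpa using hy
    gcongr
  have hmv := (convex_closedBall (0 : E) ‖t‖).norm_image_sub_le_of_norm_hasFDerivWithin_le hder
    hbound (by simp : (0 : E) ∈ _) (by simp : t ∈ Metric.closedBall (0 : E) ‖t‖)
  have hR0 : R 0 = 0 := by simp [hR]
  rw [hR0, sub_zero, sub_zero, Real.norm_eq_abs] at hmv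
  calc _ ≤ η * ‖t‖ * ‖t‖ := hmv
    _ = _ := by ring

/-- The infimum of the affine majorants of a family of uniformly semiconvex functions is both
concave and semiconvex. -/
theorem exists_affine_envelope [InnerProductSpace ℝ E] [FiniteDimensional ℝ E] {ι : Type*}
    [Nonempty ι] {F : ι → E → ℝ} (hF : ∀ i, Continuous (F i)) {k : ℝ}
    (hk : ∀ i y t, 2 * F i y - k * ‖t‖ ^ 2 ≤ F i (y + t) + F i (y - t))
    (hne : ∃ (q : E) (α : ℝ), ∀ i y, F i y ≤ α + inner ℝ q y) :
    ∃ (H : E → ℝ) (q : E → E),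
      (∀ x y, H x + inner ℝ (q x) (y - x) - k * ‖y - x‖ ^ 2 ≤ H y) ∧
      (∀ x y, H y ≤ H x + inner ℝ (q x) (y - x)) ∧ (∀ i y, F i y ≤ H y) ∧
      ∀ (q : E) (α : ℝ), (∀ i y, F i y ≤ α + inner ℝ q y) → ∀ y, H y ≤ α + inner ℝ q y := by
  classical
  set A : Set (E × ℝ) := {a | ∀ i y, F i y ≤ a.2 + inner ℝ a.1 y} with hA
  obtain ⟨q₀, α₀, h₀⟩ := hne
  have hA0 : (q₀, α₀) ∈ A := h₀
  have hAc : IsClosed A := by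
    rw [hA]
    simp only [ofPred_forall]
    refine isClosed_iInter fun i => isClosed_iInter fun y => isClosed_le continuous_const ?_
    fun_prop
  obtain ⟨i₀⟩ := ‹Nonempty ι›
  have hmin : ∀ x : E, ∃ a ∈ A, ∀ a' ∈ A, a.2 + inner ℝ a.1 x ≤ a'.2 + inner ℝ a'.1 x := by
    intro x
    set m := α₀ + inner ℝ q₀ x with hm
    obtain ⟨D, hD⟩ : ∃ D, ∀ y ∈ Metric.closedBall x 1, D ≤ F i₀ y := by
      obtain ⟨y, _, hy⟩ := (isCompact_closedBall x 1).exists_isMinOn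
        ⟨x, by simp⟩ (hF i₀).continuousOn
      exact ⟨F i₀ y, fun z hz => hy hz⟩
    set A' := A ∩ {a | a.2 + inner ℝ a.1 x ≤ m} with hA'
    have hc : Continuous fun a : E × ℝ => a.2 + inner ℝ a.1 x := by fun_prop
    have hA'c : IsClosed A' := hAc.inter (isClosed_le hc continuous_const)
    have hnorm : ∀ a ∈ A', ‖a.1‖ ≤ m - D := by
      rintro a ⟨ha, ham⟩
      have ham' : a.2 + inner ℝ a.1 x ≤ m := ham
      by_cases h : a.1 = 0
      · have h1 := ha i₀ x
        have h2 := hD x (by simp)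
        rw [h, norm_zero]
        rw [h] at h1 ham'
        linarith
      · have hp : 0 < ‖a.1‖ := norm_pos_iff.2 h
        -- A unit step against the slope lowers the affine function by `‖a.1‖`, yet it must stay
        -- above `D`; this bounds the slopes and makes the sublevel set compact.
        have h1 := ha i₀ (x - ‖a.1‖⁻¹ • a.1)
        have h2 := hD (x - ‖a.1‖⁻¹ • a.1) (by
          simp [norm_smul, hp.ne'])
        rw [inner_sub_right, inner_smul_right, real_inner_self_eq_norm_sq] at h1
        have h3 : ‖a.1‖⁻¹ * ‖a.1‖ ^ 2 = ‖a.1‖ := by field_simp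
        rw [h3] at h1
        linarith
    have hbd : Bornology.IsBounded A' := by
      refine (Metric.isBounded_iff_subset_closedBall 0).2 ⟨max (m - D)
        (max (m + (m - D) * ‖x‖) ((m - D) * ‖x‖ - D)), fun a ha => ?_⟩
      have h1 := hnorm a ha
      have h2 : |inner ℝ a.1 x| ≤ (m - D) * ‖x‖ :=
        (abs_real_inner_le_norm _ _).trans (by gcongr)
      have h3 : a.2 + inner ℝ a.1 x ≤ m := ha.2
      have h4 := ha.1 i₀ x
      have h5 := hD x (by simp)
      rw [abs_le] at h2
      rw [mem_closedBall_zero_iff, Prod.norm_def]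
      refine max_le_max h1 ?_
      rw [Real.norm_eq_abs, abs_le]
      constructor
      · have := le_max_right (m + (m - D) * ‖x‖) ((m - D) * ‖x‖ - D); linarith
      · have := le_max_left (m + (m - D) * ‖x‖) ((m - D) * ‖x‖ - D); linarith
    obtain ⟨a, ha, hamin⟩ := (Metric.isCompact_of_isClosed_isBounded hA'c hbd).exists_isMinOn
      ⟨(q₀, α₀), hA0, le_refl m⟩ hc.continuousOn
    refine ⟨a, ha.1, fun a' ha' => ?_⟩
    by_cases h : a'.2 + inner ℝ a'.1 x ≤ m
    · exact hamin ⟨ha', h⟩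
    · have h3 : a.2 + inner ℝ a.1 x ≤ m := ha.2
      linarith
  choose a haA hamin using hmin
  have hup : ∀ x y, (a y).2 + inner ℝ (a y).1 y ≤
      (a x).2 + inner ℝ (a x).1 x + inner ℝ (a x).1 (y - x) := by
    intro x y
    have := hamin y (a x) (haA x)
    rw [inner_sub_right]; linarith
  refine ⟨fun x => (a x).2 + inner ℝ (a x).1 x, fun x => (a x).1, fun x y => ?_, hup,
    fun i y => haA y i y, fun q α h y => hamin y (q, α) h⟩
  have hmid : (a x).2 + inner ℝ (a x).1 x ≤
      ((a y).2 + inner ℝ (a y).1 y + ((a (x - (y - x))).2 +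
        inner ℝ (a (x - (y - x))).1 (x - (y - x)))) / 2 + k / 2 * ‖y - x‖ ^ 2 := by
    set t := y - x with ht
    have hy : y = x + t := by rw [ht]; abel
    set b := a y
    set d := a (x - t)
    -- Averaging the optimal majorant for `x + t`, translated by `t`, with the one for `x - t`,
    -- translated by `-t`, gives an affine function which by semiconvexity majorises the family
    -- after adding `k/2 ‖t‖²`. Its value at `x` bounds the envelope there.
    have hmem : ((1 / 2 : ℝ) • (b.1 + d.1),
        (b.2 + inner ℝ b.1 t + (d.2 - inner ℝ d.1 t)) / 2 + k / 2 * ‖t‖ ^ 2) ∈ A := by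
      intro i z
      have h1 := haA y i (z + t)
      have h2 := haA (x - t) i (z - t)
      have h3 := hk i z t
      simp only [inner_smul_left, inner_add_left, inner_add_right, inner_sub_right] at h1 h2 ⊢
      simp only [conj_trivial]
      linarith
    have := hamin x _ hmem
    simp only [inner_smul_left, inner_add_left, conj_trivial] at this
    have e₁ : inner ℝ b.1 (x + t) = inner ℝ b.1 x + inner ℝ b.1 t := inner_add_right _ _ _
    have e₂ : inner ℝ d.1 (x - t) = inner ℝ d.1 x - inner ℝ d.1 t := inner_sub_right _ _ _
    rw [← hy] at e₁
    rw [e₁, e₂]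
    linarith
  have h2 := hup x (x - (y - x))
  have h3 : x - (y - x) - x = -(y - x) := by abel
  rw [h3, inner_neg_right] at h2
  dsimp only
  linarith

end SecondOrder

/-! ### Doubling of variables and the common Hessian. -/

section SecondOrder

variable {E : Type*} [NormedAddCommGroup E] [InnerProductSpace ℝ E]

/-- A function squeezed between its supporting planes and paraboloids has the slopes as its
gradient. -/
theorem hasFDerivAt_of_supporting {H : E → ℝ} {q : E → E} {k : ℝ}
    (hlow : ∀ x y, H x + inner ℝ (q x) (y - x) - k * ‖y - x‖ ^ 2 ≤ H y)
    (hup : ∀ x y, H y ≤ H x + inner ℝ (q x) (y - x)) (x : E) :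
    HasFDerivAt H (innerSL ℝ (q x)) x := by
  rw [hasFDerivAt_iff_isLittleO_nhds_zero]
  have h1 : (fun t : E => H (x + t) - H x - innerSL ℝ (q x) t) =O[𝓝 0] fun t => ‖t‖ ^ 2 := by
    refine Asymptotics.IsBigO.of_bound k (Eventually.of_forall fun t => ?_)
    have h1 := hlow x (x + t)
    have h2 := hup x (x + t)
    simp only [add_sub_cancel_left] at h1 h2
    rw [innerSL_apply_apply, Real.norm_eq_abs, norm_pow, norm_norm, abs_le]
    constructor
    · linarith
    · have : 0 ≤ k * ‖t‖ ^ 2 := by linarith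
      linarith
  exact h1.trans_isLittleO (Asymptotics.isLittleO_norm_pow_id one_lt_two)

/-- Midpoint identity behind the doubling of variables. -/
theorem doubling_identity {c : ℝ} (hc : 0 < c) (a b p y : E) :
    -c * ‖a - y‖ ^ 2 - c * ‖b - y‖ ^ 2 - inner ℝ p y =
      -(c / 2) * ‖a - b‖ ^ 2 - inner ℝ p (a + b) / 2 + ‖p‖ ^ 2 / (8 * c)
        - 2 * c * ‖y - ((1 / 2 : ℝ) • (a + b) - (1 / (4 * c)) • p)‖ ^ 2 := by
  have h : ∀ z : E, ‖z‖ ^ 2 = inner ℝ z z := fun z => (real_inner_self_eq_norm_sq z).symm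
  simp only [h, inner_add_left, inner_add_right, inner_sub_left, inner_sub_right,
    inner_smul_left, inner_smul_right, conj_trivial]
  rw [real_inner_comm a b, real_inner_comm a y, real_inner_comm b y, real_inner_comm p y,
    real_inner_comm p a, real_inner_comm p b]
  field_simp
  ring

theorem UpperSemicontinuousOn.exists_doubling_max {L : Set E} (hL : IsCompact L)
    (hne : L.Nonempty) {u v : E → ℝ} (hu : UpperSemicontinuousOn u L)
    (hv : LowerSemicontinuousOn v L) (c : ℝ) (p : E) :
    ∃ a ∈ L, ∃ b ∈ L, ∀ a' ∈ L, ∀ b' ∈ L,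
      u a' - v b' - c / 2 * ‖a' - b'‖ ^ 2 - inner ℝ p (a' + b') / 2 ≤
        u a - v b - c / 2 * ‖a - b‖ ^ 2 - inner ℝ p (a + b) / 2 := by
  have h1 : UpperSemicontinuousOn (fun z : E × E => u z.1) (L ×ˢ L) :=
    hu.comp continuousOn_fst fun z hz => hz.1
  have h2 : UpperSemicontinuousOn (fun z : E × E => -v z.2) (L ×ˢ L) := by
    have h : LowerSemicontinuousOn (fun z : E × E => v z.2) (L ×ˢ L) :=
      hv.comp continuousOn_snd fun z hz => hz.2
    exact continuous_neg.comp_lowerSemicontinuousOn_antitone h fun _ _ h => neg_le_neg h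
  have h3 : Continuous fun z : E × E =>
      -(c / 2 * ‖z.1 - z.2‖ ^ 2) - inner ℝ p (z.1 + z.2) / 2 := by fun_prop
  obtain ⟨⟨a, b⟩, hab, hmax⟩ := ((h1.add h2).add
    (h3.continuousOn.upperSemicontinuousOn)).exists_isMaxOn (hne.prod hne) (hL.prod hL)
  refine ⟨a, hab.1, b, hab.2, fun a' ha' b' hb' => ?_⟩
  have h := hmax (mk_mem_prod ha' hb')
  simp only [mem_ofPred_eq] at h
  linarith

variable [FiniteDimensional ℝ E]

/-- A set which is mapped by a Lipschitz map onto a ball is not negligible. -/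
theorem exists_mem_of_lipschitzOnWith_of_ae [MeasurableSpace E] [BorelSpace E] {K : Set E}
    {g : E → E} {C : NNReal} (hg : LipschitzOnWith C g K) {δ : ℝ} (hδ : 0 < δ)
    (hK : Metric.closedBall (0 : E) δ ⊆ g '' K) {P : E → Prop}
    (hP : ∀ᵐ x ∂(MeasureTheory.Measure.hausdorffMeasure (Module.finrank ℝ E) :
      MeasureTheory.Measure E), P x) : ∃ x ∈ K, P x := by
  by_contra! hcon
  set μ : MeasureTheory.Measure E :=
    MeasureTheory.Measure.hausdorffMeasure (Module.finrank ℝ E)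
  have hμK : μ K = 0 := by
    refine MeasureTheory.measure_mono_null (fun x hx => ?_) hP
    exact hcon x hx
  have h1 : μ (g '' K) = 0 := by
    have := hg.hausdorffMeasure_image_le (d := Module.finrank ℝ E) (by positivity)
    exact le_antisymm (this.trans (by simp [μ] at hμK; simp [hμK])) bot_le
  have h2 : μ (Metric.closedBall (0 : E) δ) = 0 := MeasureTheory.measure_mono_null hK h1
  exact (Metric.measure_closedBall_pos μ 0 hδ).ne' h2

/-- Second order form of the maximum principle for semicontinuous functions: arbitrarily small
linear perturbations of the doubled function have a maximum at which both functions are touched by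
paraboloids with almost the same Hessian. -/
theorem exists_common_hessian {L : Set E} (hL : IsCompact L) (hne : L.Nonempty) {u v : E → ℝ}
    (hu : UpperSemicontinuousOn u L) (hv : LowerSemicontinuousOn v L) {c δ : ℝ} (hc : 0 < c)
    (hδ : 0 < δ) :
    ∃ p : E, ‖p‖ ≤ δ ∧ ∃ a ∈ L, ∃ b ∈ L,
      (∀ a' ∈ L, ∀ b' ∈ L,
        u a' - v b' - c / 2 * ‖a' - b'‖ ^ 2 - inner ℝ p (a' + b') / 2 ≤
          u a - v b - c / 2 * ‖a - b‖ ^ 2 - inner ℝ p (a + b) / 2) ∧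
      ∃ (ℓ ℓ' : E →L[ℝ] ℝ) (B : E →L[ℝ] E →L[ℝ] ℝ), (∀ s t, B s t = B t s) ∧ ∀ η > 0,
        (∀ᶠ t in 𝓝 (0 : E), a + t ∈ L → u (a + t) ≤ u a + ℓ t + B t t / 2 + η * ‖t‖ ^ 2) ∧
        ∀ᶠ t in 𝓝 (0 : E), b + t ∈ L → v b + ℓ' t + B t t / 2 - η * ‖t‖ ^ 2 ≤ v (b + t) := by
  classical
  borelize E
  choose a haL b hbL hmax using
    UpperSemicontinuousOn.exists_doubling_max hL hne hu hv c
  -- The vertex of the square completed in `doubling_identity`: here the supremum over pairs of `u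
  -- a' - v b' - c‖a' - y‖² - c‖b' - y‖²` touches its supporting plane of slope `p`.
  set X : E → E := fun p => (1 / 2 : ℝ) • (a p + b p) - (1 / (4 * c)) • p with hX
  set w : E → ℝ := fun p =>
    u (a p) - v (b p) - c * ‖a p - X p‖ ^ 2 - c * ‖b p - X p‖ ^ 2 with hw
  have hpX : ∀ p, p = (2 * c) • ((a p - X p) + (b p - X p)) := by
    intro p
    have : (a p - X p) + (b p - X p) = (1 / (2 * c)) • p := by
      simp only [hX]
      match_scalars <;> field_simp <;> ring
    rw [this, smul_smul, mul_one_div_cancel (by positivity), one_smul]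
  -- the doubled function lies below its supporting planes
  have hplane : ∀ p, ∀ a' ∈ L, ∀ b' ∈ L, ∀ y,
      u a' - v b' - c * ‖a' - y‖ ^ 2 - c * ‖b' - y‖ ^ 2 ≤ w p + inner ℝ p (y - X p) := by
    intro p a' ha' b' hb' y
    have h1 := hmax p a' ha' b' hb'
    have h2 := doubling_identity hc a' b' p y
    have h3 := doubling_identity hc (a p) (b p) p (X p)
    have h4 : X p - ((1 / 2 : ℝ) • (a p + b p) - (1 / (4 * c)) • p) = 0 := sub_self _
    rw [h4, norm_zero] at h3
    have h5 : 0 ≤ 2 * c * ‖y - ((1 / 2 : ℝ) • (a' + b') - (1 / (4 * c)) • p)‖ ^ 2 := by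
      positivity
    rw [inner_sub_right]
    simp only [hw]
    linarith
  have hpar : ∀ p y, w p + inner ℝ p (y - X p) - 2 * c * ‖y - X p‖ ^ 2 =
      u (a p) - v (b p) - c * ‖a p - y‖ ^ 2 - c * ‖b p - y‖ ^ 2 := by
    intro p y
    have h1 : ∀ z, ‖z - y‖ ^ 2 = ‖z - X p‖ ^ 2 - 2 * inner ℝ (z - X p) (y - X p)
        + ‖y - X p‖ ^ 2 := by
      intro z
      rw [← norm_sub_sq_real]; congr 2; abel
    have h2 : inner ℝ p (y - X p) =
        2 * c * (inner ℝ (a p - X p) (y - X p) + inner ℝ (b p - X p) (y - X p)) := by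
      have := congrArg (fun z => inner ℝ z (y - X p)) (hpX p)
      simpa only [inner_smul_left, inner_add_left, conj_trivial] using this
    rw [h1 (a p), h1 (b p), h2]
    simp only [hw]
    ring
  have hlip : ∀ p₁ p₂, ‖p₁ - p₂‖ ≤ 4 * (2 * c) * ‖X p₁ - X p₂‖ := fun p₁ p₂ =>
    norm_slope_sub_le (by positivity)
      (fun y => (hpar p₁ y).le.trans (hplane p₂ _ (haL p₁) _ (hbL p₁) y))
      (fun y => (hpar p₂ y).le.trans (hplane p₁ _ (haL p₂) _ (hbL p₂) y))
  have hinj : Function.Injective X := by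
    intro p₁ p₂ h
    have := hlip p₁ p₂
    rw [h, sub_self, norm_zero, mul_zero] at this
    exact sub_eq_zero.1 (norm_le_zero_iff.1 this)
  set K : Set E := X '' Metric.closedBall 0 δ with hK
  set g : E → E := Function.invFun X with hg
  have hgX : ∀ p, g (X p) = p := Function.leftInverse_invFun hinj
  have hglip : LipschitzOnWith (Real.toNNReal (4 * (2 * c))) g K := by
    refine LipschitzOnWith.of_dist_le_mul ?_
    rintro _ ⟨p₁, -, rfl⟩ _ ⟨p₂, -, rfl⟩
    rw [hgX, hgX, dist_eq_norm, dist_eq_norm, Real.coe_toNNReal _ (by positivity)]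
    exact hlip p₁ p₂
  have hgK : Metric.closedBall (0 : E) δ ⊆ g '' K := by
    intro p hp
    exact ⟨X p, ⟨p, hp, rfl⟩, hgX p⟩
  -- the concave envelope of the regularization of `u`
  have hparab : ∀ z y : E, -c * ‖y - z‖ ^ 2 - c * ‖y‖ ^ 2 =
      -(2 * c) * ‖y‖ ^ 2 + 2 * c * inner ℝ z y - c * ‖z‖ ^ 2 := by
    intro z y
    rw [norm_sub_sq_real, real_inner_comm]; ring
  have : Nonempty L := hne.to_subtype
  obtain ⟨H, q, hlow, hup, hFH, hHA⟩ := exists_affine_envelope (E := E) (ι := L)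
    (F := fun z y => u z - c * ‖y - z‖ ^ 2 - c * ‖y‖ ^ 2) (fun z => by fun_prop) (k := 4 * c)
    (by
      intro z y t
      have h1 := hparab z y
      have h2 := hparab z (y + t)
      have h3 := hparab z (y - t)
      rw [norm_add_sq_real, inner_add_right] at h2
      rw [norm_sub_sq_real y t, inner_sub_right] at h3
      rw [← sub_nonneg]
      have : u z - c * ‖y + t - z‖ ^ 2 - c * ‖y + t‖ ^ 2 +
          (u z - c * ‖y - t - z‖ ^ 2 - c * ‖y - t‖ ^ 2) -
          (2 * (u z - c * ‖y - z‖ ^ 2 - c * ‖y‖ ^ 2) - 4 * c * ‖t‖ ^ 2) = 0 := by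
        rw [norm_add_sq_real, norm_sub_sq_real y t]
        linarith
      exact this.ge)
    (by
      obtain ⟨D, hD⟩ := hu.bddAbove_of_isCompact hL
      refine ⟨0, D, fun z y => ?_⟩
      have h1 : u z ≤ D := hD ⟨z, z.2, rfl⟩
      have h2 : 0 ≤ c * ‖y - z‖ ^ 2 := by positivity
      have h3 : 0 ≤ c * ‖y‖ ^ 2 := by positivity
      rw [inner_zero_left]
      linarith)
  have hupper : ∀ p, ∀ b' ∈ L, ∀ y,
      H y + c * ‖y‖ ^ 2 ≤ v b' + c * ‖b' - y‖ ^ 2 + w p + inner ℝ p (y - X p) := by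
    intro p b' hb' y
    -- The two terms `c‖y‖²` cancel, so the expression is affine in `y`. By `hplane` it majorises
    -- the whole family, hence also `H`.
    have key : ∀ y, v b' + c * ‖b' - y‖ ^ 2 + w p + inner ℝ p (y - X p) - c * ‖y‖ ^ 2 =
        (v b' + c * ‖b'‖ ^ 2 + w p - inner ℝ p (X p)) + inner ℝ (p - (2 * c) • b') y := by
      intro y
      rw [norm_sub_sq_real, inner_sub_right, inner_sub_left, inner_smul_left, conj_trivial]
      ring
    have := hHA (p - (2 * c) • b') (v b' + c * ‖b'‖ ^ 2 + w p - inner ℝ p (X p))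
      (by
        intro z y
        rw [← key y]
        have := hplane p z z.2 b' hb' y
        rw [norm_sub_rev y]
        linarith) y
    rw [← key y] at this
    linarith
  have hqlip : LipschitzWith (Real.toNNReal (4 * (4 * c))) q := by
    refine LipschitzWith.of_dist_le_mul fun x y => ?_
    rw [dist_eq_norm, dist_eq_norm, Real.coe_toNNReal _ (by positivity)]
    exact norm_slope_sub_le (by positivity) (fun z => (hlow x z).trans (hup y z))
      (fun z => (hlow y z).trans (hup x z))
  have hae := hqlip.ae_differentiableAt
    (μ := (MeasureTheory.Measure.hausdorffMeasure (Module.finrank ℝ E) :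
      MeasureTheory.Measure E))
  -- The contact points with `‖p‖ ≤ δ` are not negligible, whereas the gradient `q` is
  -- differentiable almost everywhere.
  obtain ⟨_, ⟨p, hp, rfl⟩, hdiff⟩ := exists_mem_of_lipschitzOnWith_of_ae hglip hδ hgK hae
  refine ⟨p, by simpa using hp, a p, haL p, b p, hbL p, hmax p, ?_⟩
  set h : E → ℝ := fun y => H y + c * ‖y‖ ^ 2 with hh
  set h' : E → E →L[ℝ] ℝ := fun y => innerSL ℝ (q y) + (2 * c) • innerSL ℝ y with hh'
  have hder : ∀ y, HasFDerivAt h (h' y) y := by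
    intro y
    have h1 := (hasFDerivAt_of_supporting hlow hup y).add
      ((hasStrictFDerivAt_norm_sq y).hasFDerivAt.const_mul c)
    refine h1.congr_fderiv ?_
    ext z; simp [hh']; ring
  have hder2 : HasFDerivAt h' ((innerSL ℝ).comp (fderiv ℝ q (X p)) + (2 * c) • innerSL ℝ) (X p) :=
    ((innerSL ℝ).hasFDerivAt.comp (X p) hdiff.hasFDerivAt).add
      ((innerSL ℝ).hasFDerivAt.const_smul (2 * c))
  set B : E →L[ℝ] E →L[ℝ] ℝ := (innerSL ℝ).comp (fderiv ℝ q (X p)) + (2 * c) • innerSL ℝ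
  have hsymm : ∀ s t, B s t = B t s := fun s t => second_derivative_symmetric hder hder2 s t
  have hhx₁ : u (a p) - c * ‖X p - a p‖ ^ 2 ≤ h (X p) := by
    have := hFH ⟨a p, haL p⟩ (X p)
    simp only [hh]
    simp only at this
    linarith
  have hhx₂ : h (X p) ≤ u (a p) - c * ‖X p - a p‖ ^ 2 := by
    have := hupper p (b p) (hbL p) (X p)
    rw [sub_self, inner_zero_right] at this
    simp only [hw] at this
    rw [norm_sub_rev (X p)]
    simp only [hh]
    linarith
  refine ⟨h' (X p), h' (X p) - innerSL ℝ p, B, hsymm, fun η hη => ?_⟩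
  have htay := eventually_abs_sub_taylor_le (Eventually.of_forall hder) hder2 hη
  -- Translating `a p` (or `b p`) and `X p` by the same `t` leaves the penalty unchanged, so the
  -- expansion of `h` at `X p` bounds `u` from above and `v` from below with one and the same `B`.
  constructor
  · filter_upwards [htay] with t ht haL'
    have h1 := hFH ⟨a p + t, haL'⟩ (X p + t)
    have h2 : X p + t - (a p + t) = X p - a p := by abel
    simp only [h2] at h1
    have h3 := (abs_le.1 ht).2
    have h4 : u (a p + t) - c * ‖X p - a p‖ ^ 2 ≤ h (X p + t) := by simp only [hh]; linarith
    linarith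
  · filter_upwards [htay] with t ht hbL'
    have h1 := hupper p (b p + t) hbL' (X p + t)
    have h2 : b p + t - (X p + t) = b p - X p := by abel
    rw [h2, add_sub_cancel_left] at h1
    have h3 := (abs_le.1 ht).1
    have h4 : h (X p + t) ≤ v (b p + t) + c * ‖b p - X p‖ ^ 2 + w p + inner ℝ p t := h1
    rw [norm_sub_rev (X p)] at hhx₁
    have h5 : w p = u (a p) - v (b p) - c * ‖a p - X p‖ ^ 2 - c * ‖b p - X p‖ ^ 2 := rfl
    rw [sub_apply, innerSL_apply_apply]
    linarith

end SecondOrder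

/-! ### Levi forms and the calculus of the complex Hessian. -/

section ComplexHessian

variable {n : ℕ}

/-- The Hermitian matrix of the Levi form of a real bilinear form on `ℂⁿ`. -/
noncomputable def leviMatrix : (Cn n →L[ℝ] Cn n →L[ℝ] ℝ) →ₗ[ℝ] Matrix (Fin n) (Fin n) ℂ where
  toFun B := Matrix.of fun j k =>
    let e : Fin n → Cn n := fun l => EuclideanSpace.single l (1 : ℂ)
    let ie : Fin n → Cn n := fun l => EuclideanSpace.single l Complex.I
    (((B (e j) (e k) + B (ie j) (ie k) : ℝ) : ℂ)
      + Complex.I * ((B (e j) (ie k) - B (ie j) (e k) : ℝ) : ℂ)) / 4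
  map_add' B B' := by
    ext j k
    simp only [add_apply, Matrix.of_apply, Matrix.add_apply]
    push_cast
    ring
  map_smul' t B := by
    ext j k
    simp only [smul_apply, Matrix.of_apply, Matrix.smul_apply, RingHom.id_apply,
      smul_eq_mul, Complex.real_smul]
    push_cast
    ring

theorem continuous_leviMatrix : Continuous (leviMatrix (n := n)) := by
  refine continuous_matrix fun j k => ?_
  simp only [leviMatrix, LinearMap.coe_mk, AddHom.coe_mk, Matrix.of_apply]
  fun_prop

theorem complexHessian_eq_leviMatrix (ψ : Cn n → ℝ) (z : Cn n) :
    complexHessian ψ z = leviMatrix (fderiv ℝ (fderiv ℝ ψ) z) := rfl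

theorem isHermitian_leviMatrix {B : Cn n →L[ℝ] Cn n →L[ℝ] ℝ} (hB : ∀ v w, B v w = B w v) :
    (leviMatrix B).IsHermitian := by
  ext j k
  simp only [leviMatrix, LinearMap.coe_mk, AddHom.coe_mk, Matrix.conjTranspose_apply,
    Matrix.of_apply]
  rw [hB (EuclideanSpace.single k 1) (EuclideanSpace.single j 1),
    hB (EuclideanSpace.single k Complex.I) (EuclideanSpace.single j Complex.I),
    hB (EuclideanSpace.single k Complex.I) (EuclideanSpace.single j 1),
    hB (EuclideanSpace.single k 1) (EuclideanSpace.single j Complex.I)]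
  apply Complex.ext <;> simp

theorem Cn.eq_sum_single (v : Cn n) :
    v = ∑ j, ((v j).re • EuclideanSpace.single j (1 : ℂ)
      + (v j).im • EuclideanSpace.single j Complex.I : Cn n) := by
  ext l
  simp only [WithLp.ofLp_sum, Finset.sum_apply, PiLp.add_apply, PiLp.smul_apply,
    PiLp.single_apply]
  rw [Finset.sum_eq_single l]
  · simp [Complex.re_add_im]
  · intro b _ hb; simp [hb.symm]
  · simp

/-- The entry `(j, k)` pairs `∂/∂z_j` with `∂/∂z̄_k`, so the Levi form is evaluated at the conjugate
vector. Averaging `B` over a vector and its multiple by `i` is what transfers positivity from `B` to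
its Levi matrix. -/
theorem re_leviMatrix_quadraticForm (B : Cn n →L[ℝ] Cn n →L[ℝ] ℝ) (x : Fin n → ℂ) :
    (star x ⬝ᵥ (leviMatrix B).mulVec x).re =
      (B (WithLp.toLp 2 (star x)) (WithLp.toLp 2 (star x))
        + B (WithLp.toLp 2 (Complex.I • star x)) (WithLp.toLp 2 (Complex.I • star x))) / 4 := by
  rw [Cn.eq_sum_single (WithLp.toLp 2 (star x)),
    Cn.eq_sum_single (WithLp.toLp 2 (Complex.I • star x))]
  simp only [map_sum, map_add, map_smul, sum_apply, add_apply,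
    smul_apply, dotProduct, Matrix.mulVec, Complex.re_sum, Finset.mul_sum, smul_eq_mul]
  rw [Finset.sum_comm]
  simp only [← Finset.sum_add_distrib, Finset.sum_div]
  refine Finset.sum_congr rfl fun j _ => Finset.sum_congr rfl fun k _ => ?_
  simp only [leviMatrix, LinearMap.coe_mk, AddHom.coe_mk, Matrix.of_apply, Pi.star_apply,
    Pi.smul_apply, smul_eq_mul]
  simp
  ring

theorem leviMatrix_posSemidef {B : Cn n →L[ℝ] Cn n →L[ℝ] ℝ} (hB : ∀ v w, B v w = B w v)
    (hpos : ∀ v, 0 ≤ B v v) : (leviMatrix B).PosSemidef := by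
  have hH := isHermitian_leviMatrix hB
  refine Matrix.PosSemidef.of_dotProduct_mulVec_nonneg hH fun x => ?_
  rw [Complex.nonneg_iff]
  constructor
  · rw [re_leviMatrix_quadraticForm]
    have h₁ := hpos (WithLp.toLp 2 (star x))
    have h₂ := hpos (WithLp.toLp 2 (Complex.I • star x))
    linarith
  · exact (hH.im_star_dotProduct_mulVec_self x).symm

/-- The real inner product of `ℂⁿ` as a bilinear form. -/
noncomputable def realInner (n : ℕ) : Cn n →L[ℝ] Cn n →L[ℝ] ℝ := innerSL ℝ

theorem realInner_apply (v w : Cn n) : realInner n v w = inner ℝ v w := rfl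

theorem leviMatrix_realInner : leviMatrix (realInner n) =
    (1 / 2 : ℝ) • (1 : Matrix (Fin n) (Fin n) ℂ) := by
  ext j k
  simp only [leviMatrix, LinearMap.coe_mk, AddHom.coe_mk, Matrix.of_apply, realInner_apply,
    PiLp.inner_apply, PiLp.single_apply, Matrix.smul_apply, Matrix.one_apply]
  rcases eq_or_ne j k with rfl | h
  · rw [Finset.sum_eq_single j, Finset.sum_eq_single j, Finset.sum_eq_single j,
      Finset.sum_eq_single j] <;> simp +contextual
    norm_num
  · have h' : ∀ (a b : ℂ) (i : Fin n),
        inner ℝ (if i = j then a else 0) (if i = k then b else 0) = 0 := by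
      intro a b i
      by_cases hi : i = j
      · subst hi; simp [h]
      · simp [hi]
    simp [h', h]

theorem ContDiffAt.hasFDerivAt_fderiv {E : Type*} [NormedAddCommGroup E] [NormedSpace ℝ E]
    {ψ : E → ℝ} {z : E} (h : ContDiffAt ℝ 2 ψ z) :
    (∀ᶠ y in 𝓝 z, HasFDerivAt ψ (fderiv ℝ ψ y) y) ∧
      HasFDerivAt (fderiv ℝ ψ) (fderiv ℝ (fderiv ℝ ψ) z) z := by
  constructor
  · filter_upwards [h.eventually (by simp)] with y hy
    exact (hy.differentiableAt (by simp)).hasFDerivAt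
  · exact ((h.fderiv_right (m := 1) (by norm_num)).differentiableAt (by simp)).hasFDerivAt

theorem complexHessian_eq_of_hasFDerivAt {g : Cn n → ℝ} {g' : Cn n → Cn n →L[ℝ] ℝ}
    {B : Cn n →L[ℝ] Cn n →L[ℝ] ℝ} {z : Cn n} (hg : ∀ᶠ y in 𝓝 z, HasFDerivAt g (g' y) y)
    (hB : HasFDerivAt g' B z) : complexHessian g z = leviMatrix B := by
  have h : fderiv ℝ g =ᶠ[𝓝 z] g' := hg.mono fun y hy => hy.fderiv
  rw [complexHessian_eq_leviMatrix, h.fderiv_eq, hB.fderiv]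

theorem continuousAt_complexHessian {ψ : Cn n → ℝ} {z : Cn n} (h : ContDiffAt ℝ 2 ψ z) :
    ContinuousAt (complexHessian ψ) z := by
  have h1 : ContDiffAt ℝ 1 (fderiv ℝ ψ) z := h.fderiv_right (by norm_num)
  have h2 : ContDiffAt ℝ 0 (fderiv ℝ (fderiv ℝ ψ)) z := h1.fderiv_right (by norm_num)
  exact continuous_leviMatrix.continuousAt.comp h2.continuousAt

theorem isHermitian_complexHessian {ψ : Cn n → ℝ} {z : Cn n} (h : ContDiffAt ℝ 2 ψ z) :
    (complexHessian ψ z).IsHermitian :=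
  isHermitian_leviMatrix fun v w =>
    second_derivative_symmetric_of_eventually h.hasFDerivAt_fderiv.1 h.hasFDerivAt_fderiv.2 v w

theorem contDiff_const_add_norm_sub_sq (k m : ℝ) (a : Cn n) :
    ContDiff ℝ 2 fun z : Cn n => k * ‖z - a‖ ^ 2 + m :=
  (contDiff_const.mul ((contDiff_id.sub contDiff_const).norm_sq ℝ)).add contDiff_const

theorem complexHessian_add_norm_sub_sq {ψ : Cn n → ℝ} {z : Cn n} (h : ContDiffAt ℝ 2 ψ z)
    (k m : ℝ) (a : Cn n) :
    complexHessian (fun y => ψ y + (k * ‖y - a‖ ^ 2 + m)) z =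
      complexHessian ψ z + k • (1 : Matrix (Fin n) (Fin n) ℂ) := by
  obtain ⟨h1, h2⟩ := h.hasFDerivAt_fderiv
  have h3 : ∀ᶠ y in 𝓝 z, HasFDerivAt (fun y => ψ y + (k * ‖y - a‖ ^ 2 + m))
      (fderiv ℝ ψ y + (2 * k) • realInner n (y - a)) y := by
    filter_upwards [h1] with y hy
    have h4 := (((hasStrictFDerivAt_norm_sq (y - a)).hasFDerivAt.comp y
      ((hasFDerivAt_id (𝕜 := ℝ) y).sub_const a)).const_mul k).add_const m
    refine (hy.add h4).congr_fderiv ?_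
    ext w; simp [realInner_apply]; ring
  have h5 : HasFDerivAt (fun y => fderiv ℝ ψ y + (2 * k) • realInner n (y - a))
      (fderiv ℝ (fderiv ℝ ψ) z + (2 * k) • realInner n) z := by
    have h6 : HasFDerivAt (fun y : Cn n => realInner n (y - a))
        (realInner n) z :=
      (realInner n).hasFDerivAt.comp z
        ((hasFDerivAt_id (𝕜 := ℝ) z).sub_const a)
    exact h2.add (h6.const_smul (2 * k))
  rw [complexHessian_eq_of_hasFDerivAt h3 h5, map_add, map_smul, leviMatrix_realInner, smul_smul,
    ← complexHessian_eq_leviMatrix]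
  congr 2; ring

theorem contDiff_quadratic (α : ℝ) (ℓ : Cn n →L[ℝ] ℝ) (B : Cn n →L[ℝ] Cn n →L[ℝ] ℝ) (a : Cn n) :
    ContDiff ℝ 2 fun z : Cn n => α + ℓ (z - a) + B (z - a) (z - a) / 2 := by
  fun_prop

theorem complexHessian_quadratic (α : ℝ) (ℓ : Cn n →L[ℝ] ℝ) {B : Cn n →L[ℝ] Cn n →L[ℝ] ℝ}
    (hB : ∀ v w, B v w = B w v) (a z : Cn n) :
    complexHessian (fun y => α + ℓ (y - a) + B (y - a) (y - a) / 2) z = leviMatrix B := by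
  have hd : ∀ y : Cn n, HasFDerivAt (fun y : Cn n => y - a) (ContinuousLinearMap.id ℝ _) y :=
    fun y => (hasFDerivAt_id (𝕜 := ℝ) y).sub_const a
  refine complexHessian_eq_of_hasFDerivAt (g' := fun y => ℓ + B (y - a))
    (Eventually.of_forall fun y => ?_) ?_
  · have h1 := ((ℓ.hasFDerivAt.comp y (hd y)).const_add α).add
      ((B.hasFDerivAt_of_bilinear (hd y) (hd y)).mul_const (1 / 2 : ℝ))
    have h2 : (fun y => α + ℓ (y - a) + B (y - a) (y - a) / 2) =
        fun y => α + ℓ (y - a) + B (y - a) (y - a) * (1 / 2) := by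
      funext y; ring
    rw [h2]
    refine h1.congr_fderiv ?_
    ext w
    simp [hB w y, hB w a]
    ring
  · exact (B.hasFDerivAt.comp z (hd z)).const_add ℓ

theorem nonneg_of_isLocalMin {E : Type*} [NormedAddCommGroup E] [NormedSpace ℝ E] {g : E → ℝ}
    {g' : E → E →L[ℝ] ℝ} {B : E →L[ℝ] E →L[ℝ] ℝ} {x : E}
    (hg : ∀ᶠ y in 𝓝 x, HasFDerivAt g (g' y) y) (hB : HasFDerivAt g' B x) (hmin : IsLocalMin g x)
    (v : E) : 0 ≤ B v v := by
  have h0 : g' x = 0 := hmin.hasFDerivAt_eq_zero hg.self_of_nhds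
  refine le_of_forall_pos_le_add fun ε hε => ?_
  -- Chosen so that `2 η ‖v‖² ≤ ε` after the expansion along `s • v` has been divided by `s²`.
  set η : ℝ := ε / (2 * (‖v‖ ^ 2 + 1)) with hη
  have hη0 : 0 < η := by positivity
  have htay := eventually_abs_sub_taylor_le hg hB hη0
  have ht0 : Tendsto (fun t : E => x + t) (𝓝 0) (𝓝 x) := by
    have h : Continuous fun t : E => x + t := by fun_prop
    simpa using h.tendsto 0
  have hs0 : Tendsto (fun s : ℝ => s • v) (𝓝[>] 0) (𝓝 0) := by
    have h : Continuous fun s : ℝ => s • v := by fun_prop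
    simpa using (h.tendsto 0).mono_left nhdsWithin_le_nhds
  obtain ⟨s, ⟨h1, h2⟩, hs⟩ := ((hs0.eventually (htay.and (ht0.eventually hmin))).and
    self_mem_nhdsWithin).exists
  have hs' : (0 : ℝ) < s := hs
  rw [h0, abs_le] at h1
  simp only [map_smul, smul_apply, smul_eq_mul, norm_smul, Real.norm_eq_abs, abs_of_pos hs',
    zero_apply, mul_zero] at h1
  have h3 : 0 ≤ s ^ 2 * (B v v / 2 + η * ‖v‖ ^ 2) := by nlinarith [h1.2]
  have h4 : 0 ≤ B v v / 2 + η * ‖v‖ ^ 2 := by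
    by_contra! h
    nlinarith [mul_neg_of_pos_of_neg (pow_pos hs' 2) h]
  have h5 : η * (‖v‖ ^ 2 + 1) = ε / 2 := by rw [hη]; field_simp
  nlinarith

/-- The complex Hessians are ordered where a `C²` function touches another one from below. -/
theorem posSemidef_complexHessian_sub {χ ψ : Cn n → ℝ} {z : Cn n} (hχ : ContDiffAt ℝ 2 χ z)
    (hψ : ContDiffAt ℝ 2 ψ z) (heq : χ z = ψ z) (hle : ∀ᶠ y in 𝓝 z, χ y ≤ ψ y) :
    (complexHessian ψ z - complexHessian χ z).PosSemidef := by
  obtain ⟨h1, h2⟩ := hχ.hasFDerivAt_fderiv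
  obtain ⟨h3, h4⟩ := hψ.hasFDerivAt_fderiv
  have h5 : ∀ᶠ y in 𝓝 z, HasFDerivAt (fun y => ψ y - χ y) (fderiv ℝ ψ y - fderiv ℝ χ y) y := by
    filter_upwards [h1, h3] with y hy hy' using hy'.sub hy
  have h6 := h4.sub h2
  rw [complexHessian_eq_leviMatrix, complexHessian_eq_leviMatrix, ← map_sub]
  refine leviMatrix_posSemidef (fun v w => second_derivative_symmetric_of_eventually h5 h6 v w)
    (nonneg_of_isLocalMin h5 h6 ?_)
  filter_upwards [hle] with y hy
  rw [heq, sub_self]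
  linarith

end ComplexHessian

/-! ### Monotonicity of the operator on the closed cone. -/

section Operator

variable {n : ℕ} {𝒞 : Set (Matrix (Fin n) (Fin n) ℂ)} {G : Matrix (Fin n) (Fin n) ℂ → ℝ}

/-- Each eigenvalue is the Rayleigh quotient at a unit eigenvector, where `Q` contributes a
nonnegative amount and `t • 1` exactly `t`. -/
theorem le_leastEigenvalue_add_smul_one (hn : 0 < n) {Q : Matrix (Fin n) (Fin n) ℂ}
    (hQ : Q.PosSemidef) (t : ℝ)
    (hH : (Q + t • (1 : Matrix (Fin n) (Fin n) ℂ)).IsHermitian) :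
    t ≤ leastEigenvalue _ hH := by
  have : Nonempty (Fin n) := ⟨⟨0, hn⟩⟩
  refine le_ciInf fun i => ?_
  rw [hH.eigenvalues_eq, Matrix.add_mulVec, dotProduct_add, Matrix.smul_mulVec, Matrix.one_mulVec,
    dotProduct_smul]
  have h1 := (Complex.nonneg_iff.1 (hQ.dotProduct_mulVec_nonneg
    (hH.eigenvectorBasis i).ofLp)).1
  have h2 : star (hH.eigenvectorBasis i).ofLp ⬝ᵥ (hH.eigenvectorBasis i).ofLp = (1 : ℂ) := by
    have h3 := inner_self_eq_norm_sq_to_K (𝕜 := ℂ) (hH.eigenvectorBasis i)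
    rw [hH.eigenvectorBasis.orthonormal.1 i, EuclideanSpace.inner_eq_star_dotProduct,
      dotProduct_comm] at h3
    simpa using h3
  rw [h2]
  simp only [RCLike.re_to_complex, Complex.add_re, Complex.real_smul, mul_one, Complex.ofReal_re]
  linarith

theorem posDef_add_smul_one {Q : Matrix (Fin n) (Fin n) ℂ} (hQ : Q.PosSemidef) {t : ℝ}
    (ht : 0 < t) : (Q + t • (1 : Matrix (Fin n) (Fin n) ℂ)).PosDef := by
  rw [add_comm]
  exact (Matrix.PosDef.one.smul ht).add_posSemidef hQ

namespace IsAdmissibleOperator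

theorem nonneg_of_mem_closure (hG : IsAdmissibleOperator 𝒞 G) {A : Matrix (Fin n) (Fin n) ℂ}
    (hA : A ∈ closure 𝒞) : 0 ≤ G A :=
  (hG.continuousOn.mono (subset_refl _)).image_closure.trans
    (closure_minimal (by rintro _ ⟨B, hB, rfl⟩; exact hG.nonneg B hB) isClosed_Ici) ⟨A, hA, rfl⟩

/-- The working form of the structural condition: for `t > 0` the matrix `Q + t • 1` is positive
definite with least eigenvalue at least `t`, and continuity of `G` carries the inequality to the
closed cone and to `t = 0`. -/
theorem exists_monotone_const (hG : IsAdmissibleOperator 𝒞 G) (hn : 0 < n) :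
    ∃ C : ℝ, 0 < C ∧ ∀ A ∈ closure 𝒞, ∀ Q : Matrix (Fin n) (Fin n) ℂ, Q.PosSemidef →
      ∀ t : ℝ, 0 ≤ t → A + Q + t • (1 : Matrix (Fin n) (Fin n) ℂ) ∈ closure 𝒞 ∧
        G A + C * t ≤ G (A + Q + t • (1 : Matrix (Fin n) (Fin n) ℂ)) := by
  obtain ⟨C, hC, hcomp⟩ := hG.comparison
  refine ⟨C, hC, ?_⟩
  -- strict positivity, first on the cone and then on its closure
  have hpos : ∀ A ∈ closure 𝒞, ∀ Q : Matrix (Fin n) (Fin n) ℂ, Q.PosSemidef → ∀ t : ℝ, 0 < t →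
      A + Q + t • (1 : Matrix (Fin n) (Fin n) ℂ) ∈ closure 𝒞 ∧
        G A + C * t ≤ G (A + Q + t • (1 : Matrix (Fin n) (Fin n) ℂ)) := by
    intro A hA Q hQ t ht
    have hP := posDef_add_smul_one hQ ht
    have : FirstCountableTopology (Matrix (Fin n) (Fin n) ℂ) :=
      inferInstanceAs (FirstCountableTopology (Fin n → Fin n → ℂ))
    obtain ⟨a, ha, hlim⟩ := mem_closure_iff_seq_limit.1 hA
    have hk : ∀ k, a k + Q + t • (1 : Matrix (Fin n) (Fin n) ℂ) ∈ closure 𝒞 ∧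
        G (a k) + C * t ≤ G (a k + Q + t • (1 : Matrix (Fin n) (Fin n) ℂ)) := by
      intro k
      obtain ⟨h1, h2⟩ := hcomp (a k) (ha k) _ hP
      have h3 := mul_le_mul_of_nonneg_left
        (le_leastEigenvalue_add_smul_one hn hQ t hP.isHermitian) hC.le
      rw [← add_assoc] at h1 h2
      exact ⟨h1, by linarith⟩
    have hlim' : Tendsto (fun k => a k + Q + t • (1 : Matrix (Fin n) (Fin n) ℂ)) atTop
        (𝓝 (A + Q + t • (1 : Matrix (Fin n) (Fin n) ℂ))) :=
      (hlim.add_const _).add_const _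
    have hmem := isClosed_closure.mem_of_tendsto hlim' (Eventually.of_forall fun k => (hk k).1)
    refine ⟨hmem, ?_⟩
    have hG1 : Tendsto (fun k => G (a k)) atTop (𝓝 (G A)) :=
      (hG.continuousOn A hA).tendsto.comp (tendsto_nhdsWithin_iff.2
        ⟨hlim, Eventually.of_forall fun k => subset_closure (ha k)⟩)
    have hG2 := (hG.continuousOn _ hmem).tendsto.comp (tendsto_nhdsWithin_iff.2
        ⟨hlim', Eventually.of_forall fun k => (hk k).1⟩)
    exact le_of_tendsto_of_tendsto' (hG1.add_const _) hG2 fun k => (hk k).2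
  intro A hA Q hQ t ht
  rcases ht.eq_or_lt with rfl | ht
  · have hlim : Tendsto (fun s : ℝ => A + Q + s • (1 : Matrix (Fin n) (Fin n) ℂ)) (𝓝[>] 0)
        (𝓝 (A + Q + (0 : ℝ) • (1 : Matrix (Fin n) (Fin n) ℂ))) := by
      have h : Continuous fun s : ℝ => A + Q + s • (1 : Matrix (Fin n) (Fin n) ℂ) := by fun_prop
      exact (h.tendsto 0).mono_left nhdsWithin_le_nhds
    have hev : ∀ᶠ s : ℝ in 𝓝[>] 0, A + Q + s • (1 : Matrix (Fin n) (Fin n) ℂ) ∈ closure 𝒞 ∧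
        G A + C * s ≤ G (A + Q + s • (1 : Matrix (Fin n) (Fin n) ℂ)) := by
      filter_upwards [self_mem_nhdsWithin] with s hs using hpos A hA Q hQ s hs
    have hmem := isClosed_closure.mem_of_tendsto hlim (hev.mono fun s hs => hs.1)
    refine ⟨hmem, ?_⟩
    have hG2 := (hG.continuousOn _ hmem).tendsto.comp (tendsto_nhdsWithin_iff.2
        ⟨hlim, hev.mono fun s hs => hs.1⟩)
    have hG1 : Tendsto (fun s : ℝ => G A + C * s) (𝓝[>] 0) (𝓝 (G A + C * 0)) := by
      have h : Continuous fun s : ℝ => G A + C * s := by fun_prop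
      exact (h.tendsto 0).mono_left nhdsWithin_le_nhds
    exact le_of_tendsto_of_tendsto hG1 hG2 (hev.mono fun s hs => hs.2)
  · exact hpos A hA Q hQ t ht

theorem add_posSemidef (hG : IsAdmissibleOperator 𝒞 G) (hn : 0 < n)
    {A Q : Matrix (Fin n) (Fin n) ℂ} (hA : A ∈ closure 𝒞) (hQ : Q.PosSemidef) :
    A + Q ∈ closure 𝒞 ∧ G A ≤ G (A + Q) := by
  obtain ⟨C, _, h⟩ := hG.exists_monotone_const hn
  simpa using h A hA Q hQ 0 le_rfl

/-- If `0` were in the open cone, so would be some `-(s • 1)` and all its positive multiples. Since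
`G ≥ 0` there, returning to `0` would force `G 0 ≥ C r s` for every `r`. Hence `0` is a boundary
point, where `G ≤ f`; this is what makes constants supersolutions. -/
theorem zero_notMem (hG : IsAdmissibleOperator 𝒞 G) (hn : 0 < n) : (0 : Matrix _ _ ℂ) ∉ 𝒞 := by
  intro h0
  obtain ⟨C, hC, hmono⟩ := hG.exists_monotone_const hn
  obtain ⟨U, hU, rfl⟩ := hG.isOpen
  have hlim : Tendsto (fun s : ℝ => -(s • (1 : Matrix (Fin n) (Fin n) ℂ))) (𝓝[>] 0) (𝓝 0) := by
    have h : Continuous fun s : ℝ => -(s • (1 : Matrix (Fin n) (Fin n) ℂ)) := by fun_prop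
    simpa using (h.tendsto 0).mono_left nhdsWithin_le_nhds
  obtain ⟨s, hsU, hs⟩ := ((hlim.eventually (hU.mem_nhds h0.1)).and self_mem_nhdsWithin).exists
  have hs' : (0 : ℝ) < s := hs
  have hmem : -(s • (1 : Matrix (Fin n) (Fin n) ℂ)) ∈ U ∩ {A | A.IsHermitian} :=
    ⟨hsU, ((Matrix.PosDef.one (n := Fin n) (R := ℂ)).smul hs').isHermitian.neg⟩
  have hbig : ∀ r : ℝ, 0 < r → C * (r * s) ≤ G 0 := by
    intro r hr
    have h1 := hG.smul_mem _ hmem r hr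
    have h2 := (hmono _ (subset_closure h1) 0 Matrix.PosSemidef.zero (r * s) (by positivity)).2
    have h3 := hG.nonneg _ h1
    have h4 : (r : ℂ) • -(s • (1 : Matrix (Fin n) (Fin n) ℂ)) + 0 +
        (r * s) • (1 : Matrix (Fin n) (Fin n) ℂ) = 0 := by
      rw [Complex.coe_smul, smul_neg, smul_smul]; simp
    rw [h4] at h2
    linarith
  have h5 := hbig ((|G 0| + 1) / (C * s)) (by positivity)
  have h6 : C * ((|G 0| + 1) / (C * s) * s) = |G 0| + 1 := by field_simp
  linarith [le_abs_self (G 0)]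

theorem zero_mem_closure (hG : IsAdmissibleOperator 𝒞 G) : (0 : Matrix _ _ ℂ) ∈ closure 𝒞 := by
  obtain ⟨A, hA⟩ := hG.nonempty
  have hlim : Tendsto (fun s : ℝ => (s : ℂ) • A) (𝓝[>] 0) (𝓝 0) := by
    have h : Continuous fun s : ℝ => (s : ℂ) • A := by fun_prop
    simpa using (h.tendsto 0).mono_left nhdsWithin_le_nhds
  refine mem_closure_of_tendsto hlim ?_
  filter_upwards [self_mem_nhdsWithin] with s hs using hG.smul_mem A hA s hs

end IsAdmissibleOperator

end Operator

/-! ### Semicontinuous envelopes and truncation. -/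

section Envelope

variable {n : ℕ} {Ω : Set (Cn n)} {u v : Cn n → EReal}

theorem upperEnvelope_lt_iff {z : Cn n} {c : EReal} :
    upperEnvelope Ω u z < c ↔ ∃ r : ℝ, 0 < r ∧ ⨆ y ∈ Metric.ball z r ∩ Ω, u y < c := by
  simp only [upperEnvelope, iInf_lt_iff, exists_prop]

theorem lt_lowerEnvelope_iff {z : Cn n} {c : EReal} :
    c < lowerEnvelope Ω u z ↔ ∃ r : ℝ, 0 < r ∧ c < ⨅ y ∈ Metric.ball z r ∩ Ω, u y := by
  simp only [lowerEnvelope, lt_iSup_iff, exists_prop]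

theorem upperSemicontinuous_upperEnvelope : UpperSemicontinuous (upperEnvelope Ω u) := by
  intro z c hc
  obtain ⟨r, hr, h⟩ := upperEnvelope_lt_iff.1 hc
  filter_upwards [Metric.ball_mem_nhds z (half_pos hr)] with y hy
  refine upperEnvelope_lt_iff.2 ⟨r / 2, half_pos hr, lt_of_le_of_lt ?_ h⟩
  refine biSup_mono fun x hx => ⟨Metric.ball_subset_ball' ?_ hx.1, hx.2⟩
  rw [Metric.mem_ball] at hy; linarith

theorem lowerSemicontinuous_lowerEnvelope : LowerSemicontinuous (lowerEnvelope Ω u) := by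
  intro z c hc
  obtain ⟨r, hr, h⟩ := lt_lowerEnvelope_iff.1 hc
  filter_upwards [Metric.ball_mem_nhds z (half_pos hr)] with y hy
  refine lt_lowerEnvelope_iff.2 ⟨r / 2, half_pos hr, h.trans_le ?_⟩
  refine biInf_mono fun x hx => ⟨Metric.ball_subset_ball' ?_ hx.1, hx.2⟩
  rw [Metric.mem_ball] at hy; linarith

theorem le_upperEnvelope {z : Cn n} (hz : z ∈ Ω) : u z ≤ upperEnvelope Ω u z :=
  le_iInf₂ fun _ hr => le_biSup u ⟨Metric.mem_ball_self hr, hz⟩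

theorem lowerEnvelope_le {z : Cn n} (hz : z ∈ Ω) : lowerEnvelope Ω u z ≤ u z :=
  iSup₂_le fun _ hr => biInf_le u ⟨Metric.mem_ball_self hr, hz⟩

theorem upperEnvelope_mono (h : ∀ z ∈ Ω, u z ≤ v z) (z : Cn n) :
    upperEnvelope Ω u z ≤ upperEnvelope Ω v z :=
  iInf₂_mono fun _ _ => iSup₂_mono fun y hy => h y hy.2

theorem lowerEnvelope_mono (h : ∀ z ∈ Ω, u z ≤ v z) (z : Cn n) :
    lowerEnvelope Ω u z ≤ lowerEnvelope Ω v z :=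
  iSup₂_mono fun _ _ => iInf₂_mono fun y hy => h y hy.2

theorem upperEnvelope_le_of_eventually {z : Cn n} {c : EReal}
    (h : ∀ᶠ y in 𝓝[Ω] z, u y ≤ c) : upperEnvelope Ω u z ≤ c := by
  obtain ⟨r, hr, h⟩ := Metric.mem_nhdsWithin_iff.1 h
  exact (iInf₂_le r hr).trans (iSup₂_le fun y hy => h hy)

theorem le_lowerEnvelope_of_eventually {z : Cn n} {c : EReal}
    (h : ∀ᶠ y in 𝓝[Ω] z, c ≤ u y) : c ≤ lowerEnvelope Ω u z := by
  obtain ⟨r, hr, h⟩ := Metric.mem_nhdsWithin_iff.1 h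
  unfold lowerEnvelope
  exact le_iSup_of_le r (le_iSup_of_le hr (le_iInf₂ fun y hy => h hy))

theorem upperEnvelope_eq (hu : UpperSemicontinuousOn u Ω) {z : Cn n} (hz : z ∈ Ω) :
    upperEnvelope Ω u z = u z :=
  le_antisymm (le_of_forall_gt_imp_ge_of_dense fun c hc =>
    upperEnvelope_le_of_eventually ((hu z hz c hc).mono fun _ h => h.le)) (le_upperEnvelope hz)

theorem lowerEnvelope_eq (hu : LowerSemicontinuousOn u Ω) {z : Cn n} (hz : z ∈ Ω) :
    lowerEnvelope Ω u z = u z :=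
  le_antisymm (lowerEnvelope_le hz) (le_of_forall_lt_imp_le_of_dense fun c hc =>
    le_lowerEnvelope_of_eventually ((hu z hz c hc).mono fun _ h => h.le))

theorem eventually_lt_of_upperEnvelope_lt {z : Cn n} {c : EReal} (h : upperEnvelope Ω u z < c) :
    ∀ᶠ y in 𝓝[Ω] z, u y < c := by
  filter_upwards [mem_nhdsWithin_of_mem_nhds (upperSemicontinuous_upperEnvelope z c h),
    self_mem_nhdsWithin] with y hy hyΩ using (le_upperEnvelope hyΩ).trans_lt hy

theorem eventually_lt_of_lt_lowerEnvelope {z : Cn n} {c : EReal} (h : c < lowerEnvelope Ω u z) :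
    ∀ᶠ y in 𝓝[Ω] z, c < u y := by
  filter_upwards [mem_nhdsWithin_of_mem_nhds (lowerSemicontinuous_lowerEnvelope z c h),
    self_mem_nhdsWithin] with y hy hyΩ using hy.trans_le (lowerEnvelope_le hyΩ)

/-- Truncation of an extended real number at the heights `±N`. -/
noncomputable def clamp (N : ℝ) (w : EReal) : ℝ := (max ((-N : ℝ) : EReal) (min w N)).toReal

theorem coe_clamp (N : ℝ) (w : EReal) :
    (clamp N w : EReal) = max ((-N : ℝ) : EReal) (min w N) := by
  refine EReal.coe_toReal (ne_of_lt ?_) (ne_of_gt ?_)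
  · exact max_lt (EReal.coe_lt_top _) ((min_le_right _ _).trans_lt (EReal.coe_lt_top _))
  · exact (EReal.bot_lt_coe _).trans_le (le_max_left _ _)

theorem clamp_mono (N : ℝ) : Monotone (clamp N) := by
  intro a b h
  rw [← EReal.coe_le_coe_iff, coe_clamp, coe_clamp]
  exact max_le_max le_rfl (min_le_min h le_rfl)

theorem continuous_clamp (N : ℝ) : Continuous (clamp N) := by
  have h : Continuous fun w => (clamp N w : EReal) := by
    simp only [coe_clamp]; fun_prop
  exact EReal.isEmbedding_coe.continuous_iff.2 h

theorem clamp_coe {N x : ℝ} (hx : |x| ≤ N) : clamp N x = x := by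
  rw [abs_le] at hx
  rw [← EReal.coe_eq_coe_iff, coe_clamp, min_eq_left (by exact_mod_cast hx.2),
    max_eq_right (by exact_mod_cast hx.1)]

theorem le_clamp {N : ℝ} {w : EReal} (hw : w ≤ N) : w ≤ clamp N w := by
  rw [coe_clamp, min_eq_left hw]; exact le_max_right _ _

theorem clamp_le {N : ℝ} {w : EReal} (hw : ((-N : ℝ) : EReal) ≤ w) :
    (clamp N w : EReal) ≤ w := by
  rw [coe_clamp]; exact max_le hw (min_le_left _ _)

theorem clamp_le_of_lt {N : ℝ} {w : EReal} (hw : -N < clamp N w) :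
    (clamp N w : EReal) ≤ w := by
  rw [← EReal.coe_lt_coe_iff, coe_clamp] at hw
  rw [coe_clamp]
  rcases lt_max_iff.1 hw with h | h
  · exact absurd h (lt_irrefl _)
  · exact max_le (h.le.trans (min_le_left _ _)) (min_le_left _ _)

theorem le_clamp_of_lt {N : ℝ} {w : EReal} (hw : clamp N w < N) :
    w ≤ clamp N w := by
  rw [← EReal.coe_lt_coe_iff, coe_clamp] at hw
  refine le_clamp (le_of_lt ?_)
  have h := (le_max_right _ _).trans_lt hw
  rcases min_lt_iff.1 h with h | h
  · exact h
  · exact absurd h (lt_irrefl _)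

end Envelope

/-! ### The comparison principle. -/

section Comparison

variable {n : ℕ} {𝒞 : Set (Matrix (Fin n) (Fin n) ℂ)} {G : Matrix (Fin n) (Fin n) ℂ → ℝ}
  {f : Cn n → ℝ} {Ω : Set (Cn n)} {u v : Cn n → EReal}

/-- If a subsolution, made strict by a multiple of `‖z‖²`, and a supersolution are touched by
paraboloids with a common Hessian, the right hand sides at the two points differ by a definite
amount. -/
theorem add_le_of_common_hessian (hΩ : IsOpen Ω) (hu : IsViscositySubsolution 𝒞 G f Ω u)
    (hv : IsViscositySupersolution 𝒞 G f Ω v) {C : ℝ}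
    (hC : ∀ A ∈ closure 𝒞, ∀ Q : Matrix (Fin n) (Fin n) ℂ, Q.PosSemidef →
      ∀ t : ℝ, 0 ≤ t → A + Q + t • (1 : Matrix (Fin n) (Fin n) ℂ) ∈ closure 𝒞 ∧
        G A + C * t ≤ G (A + Q + t • (1 : Matrix (Fin n) (Fin n) ℂ)))
    {U V : Cn n → ℝ} (huU : ∀ z ∈ Ω, u z ≤ U z) (hVv : ∀ z ∈ Ω, (V z : EReal) ≤ v z)
    {a b : Cn n} (ha : a ∈ Ω) (hb : b ∈ Ω) (hua : (U a : EReal) = u a) (hvb : (V b : EReal) = v b)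
    {ε : ℝ} (hε : 0 < ε) {ℓ ℓ' : Cn n →L[ℝ] ℝ} {B : Cn n →L[ℝ] Cn n →L[ℝ] ℝ}
    (hB : ∀ s t, B s t = B t s)
    (hUB : ∀ η > 0, ∀ᶠ t in 𝓝 (0 : Cn n), a + t ∈ closure Ω →
      U (a + t) + ε * ‖a + t‖ ^ 2 ≤ U a + ε * ‖a‖ ^ 2 + ℓ t + B t t / 2 + η * ‖t‖ ^ 2)
    (hVB : ∀ η > 0, ∀ᶠ t in 𝓝 (0 : Cn n), b + t ∈ closure Ω →
      V b + ℓ' t + B t t / 2 - η * ‖t‖ ^ 2 ≤ V (b + t)) :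
    f a + C * (ε / 2) ≤ f b := by
  have htend : ∀ x : Cn n, Tendsto (fun z => z - x) (𝓝 x) (𝓝 0) := fun x => by
    have h : Continuous fun z : Cn n => z - x := by fun_prop
    simpa using h.tendsto x
  set q₁ : Cn n → ℝ := fun z => (U a + ε * ‖a‖ ^ 2) + ℓ (z - a) + B (z - a) (z - a) / 2 with hq₁
  set q₂ : Cn n → ℝ := fun z => V b + ℓ' (z - b) + B (z - b) (z - b) / 2 with hq₂
  have hc₁ : ContDiff ℝ 2 q₁ := contDiff_quadratic _ _ _ _
  have hc₂ : ContDiff ℝ 2 q₂ := contDiff_quadratic _ _ _ _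
  -- Each paraboloid is opened by `ε / 4` to absorb the expansion error, and `ε‖z‖²` is removed
  -- again. The two complex Hessians then differ by `ε - ε/4 - ε/4 = ε/2` times the identity.
  set ψ₁ : Cn n → ℝ := fun z => (q₁ z + (ε / 4 * ‖z - a‖ ^ 2 + 0)) + (-ε * ‖z - 0‖ ^ 2 + 0)
    with hψ₁
  set ψ₂ : Cn n → ℝ := fun z => q₂ z + (-(ε / 4) * ‖z - b‖ ^ 2 + 0) with hψ₂
  have hc₁' : ContDiff ℝ 2 fun z => q₁ z + (ε / 4 * ‖z - a‖ ^ 2 + 0) :=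
    hc₁.add (contDiff_const_add_norm_sub_sq _ _ _)
  have hH₁ : complexHessian ψ₁ a = leviMatrix B + (ε / 4) • (1 : Matrix (Fin n) (Fin n) ℂ)
      + (-ε) • (1 : Matrix (Fin n) (Fin n) ℂ) := by
    rw [hψ₁, complexHessian_add_norm_sub_sq hc₁'.contDiffAt,
      complexHessian_add_norm_sub_sq hc₁.contDiffAt, hq₁, complexHessian_quadratic _ _ hB]
  have hH₂ : complexHessian ψ₂ b = leviMatrix B + (-(ε / 4)) • (1 : Matrix (Fin n) (Fin n) ℂ) := by
    rw [hψ₂, complexHessian_add_norm_sub_sq hc₂.contDiffAt, hq₂, complexHessian_quadratic _ _ hB]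
  have ht₁ : TouchesFromAbove ψ₁ u a := by
    refine ⟨(hc₁'.add (contDiff_const_add_norm_sub_sq _ _ _)).contDiffAt, ?_, ?_⟩
    · rw [← hua, EReal.coe_eq_coe_iff]; simp [hψ₁, hq₁]
    · filter_upwards [(htend a).eventually (hUB (ε / 4) (by positivity)), hΩ.mem_nhds ha]
        with z hz hzΩ
      rw [add_sub_cancel] at hz
      refine (huU z hzΩ).trans (EReal.coe_le_coe_iff.2 ?_)
      have := hz (subset_closure hzΩ)
      simp only [hψ₁, hq₁, sub_zero]
      linarith
  have ht₂ : TouchesFromBelow ψ₂ v b := by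
    refine ⟨(hc₂.add (contDiff_const_add_norm_sub_sq _ _ _)).contDiffAt, ?_, ?_⟩
    · rw [← hvb, EReal.coe_eq_coe_iff]; simp [hψ₂, hq₂]
    · filter_upwards [(htend b).eventually (hVB (ε / 4) (by positivity)), hΩ.mem_nhds hb]
        with z hz hzΩ
      rw [add_sub_cancel] at hz
      refine le_trans (EReal.coe_le_coe_iff.2 ?_) (hVv z hzΩ)
      have := hz (subset_closure hzΩ)
      simp only [hψ₂, hq₂]
      linarith
  obtain ⟨h1, h2⟩ := hu.le_operator a ha ψ₁ ht₁
  obtain ⟨h3, h4⟩ := hC _ h1 0 Matrix.PosSemidef.zero (ε / 2) (by positivity)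
  have h5 : complexHessian ψ₁ a + 0 + (ε / 2) • (1 : Matrix (Fin n) (Fin n) ℂ) =
      complexHessian ψ₂ b := by
    rw [hH₁, hH₂]; module
  rw [h5] at h3 h4
  have h6 := hv.operator_le b hb ψ₂ ht₂ h3
  linarith

theorem EReal.exists_nat_le_of_lt_top {w : EReal} (hw : w < ⊤) :
    ∃ N : ℕ, w ≤ ((N : ℝ) : EReal) := by
  induction w with
  | bot => exact ⟨0, bot_le⟩
  | coe x =>
    obtain ⟨N, hN⟩ := exists_nat_ge x
    exact ⟨N, EReal.coe_le_coe_iff.2 hN⟩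
  | top => exact absurd hw (lt_irrefl _)

/-- Semicontinuous functions attain their extrema on the compact closure. The bounds are one-sided:
the subsolution may still be unbounded below and the supersolution above, hence the later
truncation. -/
theorem exists_envelope_bounds (hne : Ω.Nonempty) (hΩb : Bornology.IsBounded Ω)
    (hu : ∀ z ∈ closure Ω, upperEnvelope Ω u z < ⊤)
    (hv : ∀ z ∈ closure Ω, ⊥ < lowerEnvelope Ω v z) :
    ∃ N : ℝ, 0 ≤ N ∧ (∀ z ∈ closure Ω, upperEnvelope Ω u z ≤ N) ∧
      ∀ z ∈ closure Ω, ((-N : ℝ) : EReal) ≤ lowerEnvelope Ω v z := by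
  have hK : IsCompact (closure Ω) := hΩb.isCompact_closure
  obtain ⟨z₁, hz₁, h₁⟩ := (upperSemicontinuous_upperEnvelope (Ω := Ω) (u := u)
    |>.upperSemicontinuousOn (closure Ω)).exists_isMaxOn hne.closure hK
  obtain ⟨z₂, hz₂, h₂⟩ := (lowerSemicontinuous_lowerEnvelope (Ω := Ω) (u := v)
    |>.lowerSemicontinuousOn (closure Ω)).exists_isMinOn hne.closure hK
  obtain ⟨N₁, hN₁⟩ := EReal.exists_nat_le_of_lt_top (hu z₁ hz₁)
  have h₃ : -lowerEnvelope Ω v z₂ < ⊤ := by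
    rw [EReal.neg_lt_comm]; simpa using hv z₂ hz₂
  obtain ⟨N₂, hN₂⟩ := EReal.exists_nat_le_of_lt_top h₃
  refine ⟨N₁ + N₂, by positivity, fun z hz => ?_, fun z hz => ?_⟩
  · refine ((h₁ hz).trans hN₁).trans (EReal.coe_le_coe_iff.2 ?_)
    have : (0 : ℝ) ≤ N₂ := by positivity
    linarith
  · refine le_trans (le_trans (EReal.coe_le_coe_iff.2 (?_ : _ ≤ -(N₂ : ℝ))) ?_) (h₂ hz)
    · have : (0 : ℝ) ≤ N₁ := by positivity
      linarith
    · rw [EReal.coe_neg]; exact EReal.neg_le_of_neg_le hN₂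

/-- **Comparison principle** for semicontinuous sub- and supersolutions. -/
theorem IsViscositySubsolution.le_supersolution (hn : 0 < n) (hG : IsAdmissibleOperator 𝒞 G)
    (hΩ : IsOpen Ω) (hΩb : Bornology.IsBounded Ω) (hf : ContinuousOn f (closure Ω))
    (hu : IsViscositySubsolution 𝒞 G f Ω u) (hv : IsViscositySupersolution 𝒞 G f Ω v)
    {φ : Cn n → ℝ} (huφ : ∀ ζ ∈ frontier Ω, upperEnvelope Ω u ζ ≤ φ ζ)
    (hvφ : ∀ ζ ∈ frontier Ω, (φ ζ : EReal) ≤ lowerEnvelope Ω v ζ) : ∀ z ∈ Ω, u z ≤ v z := by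
  intro z₀ hz₀
  by_contra! hlt
  obtain ⟨C, hC, hmono⟩ := hG.exists_monotone_const hn
  have hK : IsCompact (closure Ω) := hΩb.isCompact_closure
  have hcl : ∀ z ∈ closure Ω, z ∉ Ω → z ∈ frontier Ω := fun z hz hz' => by
    rw [hΩ.frontier_eq]; exact ⟨hz, hz'⟩
  obtain ⟨N, hN, huN, hvN⟩ := exists_envelope_bounds (u := u) (v := v) ⟨z₀, hz₀⟩ hΩb
    (fun z hz => by
      by_cases h : z ∈ Ω
      · rw [upperEnvelope_eq hu.upperSemicontinuousOn h]; exact hu.lt_top z h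
      · exact (huφ z (hcl z hz h)).trans_lt (EReal.coe_lt_top _))
    (fun z hz => by
      by_cases h : z ∈ Ω
      · rw [lowerEnvelope_eq hv.lowerSemicontinuousOn h]; exact hv.bot_lt z h
      · exact (EReal.bot_lt_coe _).trans_le (hvφ z (hcl z hz h)))
  set U : Cn n → ℝ := fun z => clamp (N + 1) (upperEnvelope Ω u z) with hU
  set V : Cn n → ℝ := fun z => clamp (N + 1) (lowerEnvelope Ω v z) with hV
  have hUusc : UpperSemicontinuous U :=
    (continuous_clamp (N + 1)).comp_upperSemicontinuous upperSemicontinuous_upperEnvelope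
      (clamp_mono (N + 1))
  have hVlsc : LowerSemicontinuous V :=
    (continuous_clamp (N + 1)).comp_lowerSemicontinuous lowerSemicontinuous_lowerEnvelope
      (clamp_mono (N + 1))
  have hle : (N : EReal) ≤ ((N + 1 : ℝ) : EReal) := EReal.coe_le_coe_iff.2 (by linarith)
  have hle' : ((-(N + 1) : ℝ) : EReal) ≤ ((-N : ℝ) : EReal) :=
    EReal.coe_le_coe_iff.2 (by linarith)
  have hUN : ∀ z ∈ closure Ω, U z ≤ N := fun z hz => by
    have := clamp_mono (N + 1) (huN z hz)
    rwa [clamp_coe (by rw [abs_of_nonneg hN]; linarith)] at this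
  have hVN : ∀ z ∈ closure Ω, -N ≤ V z := fun z hz => by
    have := clamp_mono (N + 1) (hvN z hz)
    rwa [clamp_coe (by rw [abs_neg, abs_of_nonneg hN]; linarith)] at this
  have huU : ∀ z ∈ Ω, u z ≤ U z := fun z hz =>
    (le_upperEnvelope hz).trans (le_clamp ((huN z (subset_closure hz)).trans hle))
  have hVv : ∀ z ∈ Ω, (V z : EReal) ≤ v z := fun z hz =>
    (clamp_le (hle'.trans (hvN z (subset_closure hz)))).trans (lowerEnvelope_le hz)
  have hbdry : ∀ z ∈ frontier Ω, U z ≤ V z := fun z hz =>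
    clamp_mono (N + 1) ((huφ z hz).trans (hvφ z hz))
  have hgap : V z₀ < U z₀ := by
    rw [← EReal.coe_lt_coe_iff]
    exact (hVv z₀ hz₀).trans_lt (hlt.trans_le (huU z₀ hz₀))
  set m := U z₀ - V z₀ with hm
  have hm0 : 0 < m := by linarith
  obtain ⟨R, hR0, hR⟩ : ∃ R : ℝ, 0 < R ∧ ∀ z ∈ closure Ω, ‖z‖ ≤ R := by
    obtain ⟨R, hR⟩ := hK.isBounded.exists_norm_le
    exact ⟨max R 1, by positivity, fun z hz => (hR z hz).trans (le_max_left _ _)⟩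
  -- With this value the perturbation `ε‖z‖²` costs at most half of the gap `m` on the closure.
  set ε : ℝ := m / (2 * R ^ 2) with hε
  have hε0 : 0 < ε := by positivity
  have hεR : ε * R ^ 2 = m / 2 := by rw [hε]; field_simp
  have hεz : ∀ z ∈ closure Ω, ε * ‖z‖ ^ 2 ≤ m / 2 := fun z hz => by
    rw [← hεR]; have := hR z hz; gcongr
  have hεz' : ∀ z : Cn n, 0 ≤ ε * ‖z‖ ^ 2 := fun z => by positivity
  set W : Cn n → ℝ := fun z => U z + ε * ‖z‖ ^ 2 with hW
  have hWusc : UpperSemicontinuous W := by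
    have h : Continuous fun z : Cn n => ε * ‖z‖ ^ 2 := by fun_prop
    exact hUusc.add h.upperSemicontinuous
  have hexists : ∀ k : ℕ, ∃ a ∈ closure Ω, ∃ b ∈ closure Ω,
      (k + 1 : ℝ) / 2 * ‖a - b‖ ^ 2 + m - 2 * R / (k + 1) ≤ W a - V b ∧
      ∃ (ℓ ℓ' : Cn n →L[ℝ] ℝ) (B : Cn n →L[ℝ] Cn n →L[ℝ] ℝ), (∀ s t, B s t = B t s) ∧ ∀ η > 0,
        (∀ᶠ t in 𝓝 (0 : Cn n), a + t ∈ closure Ω →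
          W (a + t) ≤ W a + ℓ t + B t t / 2 + η * ‖t‖ ^ 2) ∧
        ∀ᶠ t in 𝓝 (0 : Cn n), b + t ∈ closure Ω →
          V b + ℓ' t + B t t / 2 - η * ‖t‖ ^ 2 ≤ V (b + t) := by
    intro k
    obtain ⟨p, hp, a, ha, b, hb, hmax, hB⟩ := exists_common_hessian hK ⟨z₀, subset_closure hz₀⟩
      (hWusc.upperSemicontinuousOn _) (hVlsc.lowerSemicontinuousOn _)
      (c := k + 1) (δ := 1 / (k + 1)) (by positivity) (by positivity)
    refine ⟨a, ha, b, hb, ?_, hB⟩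
    have h1 := hmax z₀ (subset_closure hz₀) z₀ (subset_closure hz₀)
    have hin : ∀ x ∈ closure Ω, ∀ y ∈ closure Ω, |inner ℝ p (x + y)| ≤ 2 * R / (k + 1) := by
      intro x hx y hy
      calc |inner ℝ p (x + y)| ≤ ‖p‖ * ‖x + y‖ := abs_real_inner_le_norm _ _
        _ ≤ (1 / (k + 1)) * (2 * R) := by
          have := norm_add_le x y
          have h2 : ‖x + y‖ ≤ 2 * R := by linarith [hR x hx, hR y hy]
          gcongr
        _ = 2 * R / (k + 1) := by ring
    have h2 := abs_le.1 (hin z₀ (subset_closure hz₀) z₀ (subset_closure hz₀))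
    have h3 := abs_le.1 (hin a ha b hb)
    rw [sub_self, norm_zero] at h1
    have h4 : m ≤ W z₀ - V z₀ := by simp only [hW]; linarith [hεz' z₀]
    linarith
  choose a ha b hb hab ℓ ℓ' B hB hexp using hexists
  obtain ⟨x, hx, θ, hθ, hax⟩ := hK.tendsto_subseq ha
  have hθinf := hθ.tendsto_atTop
  have hrec : Tendsto (fun k : ℕ => 2 * R / ((k : ℝ) + 1)) atTop (𝓝 0) := by
    have := (tendsto_one_div_add_atTop_nhds_zero_nat (𝕜 := ℝ)).const_mul (2 * R)
    rw [mul_zero] at this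
    refine this.congr fun k => ?_
    ring
  have hdist : Tendsto (fun k => ‖a k - b k‖) atTop (𝓝 0) := by
    have h1 : Tendsto (fun k => ‖a k - b k‖ ^ 2) atTop (𝓝 0) := by
      have h2 := (tendsto_one_div_add_atTop_nhds_zero_nat (𝕜 := ℝ)).const_mul
        (2 * (2 * N + m + 2 * R))
      rw [mul_zero] at h2
      refine squeeze_zero (fun k => by positivity) (fun k => ?_) h2
      have h3 := hab k
      have h4 := hUN (a k) (ha k)
      have h5 := hVN (b k) (hb k)
      have h6 := hεz (a k) (ha k)
      have hk : (0 : ℝ) < k + 1 := by positivity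
      have h7 : 2 * R / ((k : ℝ) + 1) ≤ 2 * R := by
        apply div_le_self (by positivity)
        have : (0 : ℝ) ≤ k := by positivity
        linarith
      have h8 : (k + 1 : ℝ) * ‖a k - b k‖ ^ 2 ≤ 2 * (2 * N + m + 2 * R) := by
        simp only [hW] at h3
        linarith
      rw [mul_one_div, le_div_iff₀ hk]
      linarith
    have h2 := h1.sqrt
    simpa using h2
  have hbx : Tendsto (b ∘ θ) atTop (𝓝 x) := by
    have h1 : Tendsto (fun k => a (θ k) - b (θ k)) atTop (𝓝 0) :=
      tendsto_zero_iff_norm_tendsto_zero.2 (hdist.comp hθinf)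
    have h2 := hax.sub h1
    rw [sub_zero] at h2
    refine h2.congr fun k => ?_
    simp
  have hsmall : ∀ᶠ k in atTop, 2 * R / ((θ k : ℝ) + 1) < m / 8 :=
    (hrec.comp hθinf).eventually (gt_mem_nhds (by positivity))
  -- On the boundary `U ≤ V`, so semicontinuity would leave `W a - V b` at most `m/2 + m/4`, while
  -- doubling keeps it above `m - m/8`.
  have hxΩ : x ∈ Ω := by
    by_contra hxΩ
    have h1 := hbdry x (hcl x hx hxΩ)
    have h2 := hax.eventually (hWusc x (W x + m / 8) (by linarith))
    have h3 := hbx.eventually (hVlsc x (V x - m / 8) (by linarith))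
    obtain ⟨k, ⟨h4, h5⟩, h6⟩ := ((h2.and h3).and hsmall).exists
    have h7 := hab (θ k)
    have h8 : 0 ≤ ((θ k : ℝ) + 1) / 2 * ‖a (θ k) - b (θ k)‖ ^ 2 := by positivity
    have h9 := hεz x hx
    simp only [hW, Function.comp] at h4 h5 h7
    linarith
  have hfx : ContinuousAt f x := (hf x hx).continuousAt (mem_of_superset (hΩ.mem_nhds hxΩ)
    subset_closure)
  have hdiff : Tendsto (fun k => f (b (θ k)) - f (a (θ k))) atTop (𝓝 0) := by
    have := (hfx.tendsto.comp hbx).sub (hfx.tendsto.comp hax)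
    rw [sub_self] at this
    exact this
  obtain ⟨k, ⟨h1, h2⟩, h3, h4⟩ := (((hax.eventually (hΩ.mem_nhds hxΩ)).and
    (hbx.eventually (hΩ.mem_nhds hxΩ))).and ((hdiff.eventually (gt_mem_nhds
      (by positivity : (0 : ℝ) < C * (ε / 2)))).and hsmall)).exists
  replace h1 : a (θ k) ∈ Ω := h1
  replace h2 : b (θ k) ∈ Ω := h2
  have h5 := hab (θ k)
  have h6 : 0 ≤ ((θ k : ℝ) + 1) / 2 * ‖a (θ k) - b (θ k)‖ ^ 2 := by positivity
  have h7 := hεz _ (ha (θ k))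
  have h8 := hUN _ (ha (θ k))
  have h9 := hVN _ (hb (θ k))
  simp only [hW] at h5
  -- The truncation is inactive here: the remaining gap forces `U a > V b ≥ -N` and, likewise, `V b
  -- < U a ≤ N`.
  have hua : (U (a (θ k)) : EReal) = u (a (θ k)) := by
    refine le_antisymm ?_ (huU _ h1)
    have := clamp_le_of_lt (w := upperEnvelope Ω u (a (θ k)))
      (by change -(N + 1) < U (a (θ k)); linarith)
    exact this.trans_eq (upperEnvelope_eq hu.upperSemicontinuousOn h1)
  have hvb : (V (b (θ k)) : EReal) = v (b (θ k)) := by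
    refine le_antisymm (hVv _ h2) ?_
    have := le_clamp_of_lt (w := lowerEnvelope Ω v (b (θ k)))
      (by change V (b (θ k)) < N + 1; linarith)
    exact (lowerEnvelope_eq hv.lowerSemicontinuousOn h2).symm.trans_le this
  have := add_le_of_common_hessian hΩ hu hv hmono huU hVv h1 h2 hua hvb hε0 (hB (θ k))
    (fun η hη => (hexp (θ k) η hη).1) (fun η hη => (hexp (θ k) η hη).2)
  linarith

end Comparison

/-! ### Stability of subsolutions and the Perron bump. -/

section Perron

variable {n : ℕ} {𝒞 : Set (Matrix (Fin n) (Fin n) ℂ)} {G : Matrix (Fin n) (Fin n) ℂ → ℝ}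
  {f : Cn n → ℝ} {Ω : Set (Cn n)} {u v : Cn n → EReal}

theorem IsViscositySubsolution.congr (hΩ : IsOpen Ω) (hu : IsViscositySubsolution 𝒞 G f Ω u)
    (h : ∀ z ∈ Ω, u z = v z) : IsViscositySubsolution 𝒞 G f Ω v where
  upperSemicontinuousOn := by
    intro z hz c hc
    rw [← h z hz] at hc
    filter_upwards [hu.upperSemicontinuousOn z hz c hc, self_mem_nhdsWithin] with y hy hyΩ
    rwa [← h y hyΩ]
  lt_top z hz := h z hz ▸ hu.lt_top z hz
  proper := by
    obtain ⟨z, hz, hne⟩ := hu.proper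
    exact ⟨z, hz, h z hz ▸ hne⟩
  le_operator z₀ hz₀ ψ hψ := by
    refine hu.le_operator z₀ hz₀ ψ ⟨hψ.1, hψ.2.1.trans (h z₀ hz₀).symm, ?_⟩
    filter_upwards [hψ.2.2, hΩ.mem_nhds hz₀] with y hy hyΩ
    rwa [h y hyΩ]

theorem IsViscositySupersolution.congr (hΩ : IsOpen Ω) (hu : IsViscositySupersolution 𝒞 G f Ω u)
    (h : ∀ z ∈ Ω, u z = v z) : IsViscositySupersolution 𝒞 G f Ω v where
  lowerSemicontinuousOn := by
    intro z hz c hc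
    rw [← h z hz] at hc
    filter_upwards [hu.lowerSemicontinuousOn z hz c hc, self_mem_nhdsWithin] with y hy hyΩ
    rwa [← h y hyΩ]
  bot_lt z hz := h z hz ▸ hu.bot_lt z hz
  proper := by
    obtain ⟨z, hz, hne⟩ := hu.proper
    exact ⟨z, hz, h z hz ▸ hne⟩
  operator_le z₀ hz₀ ψ hψ := by
    refine hu.operator_le z₀ hz₀ ψ ⟨hψ.1, hψ.2.1.trans (h z₀ hz₀).symm, ?_⟩
    filter_upwards [hψ.2.2, hΩ.mem_nhds hz₀] with y hy hyΩ
    rwa [h y hyΩ]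

/-- Raising a subsolution at some points to functions which are touched from below there by
classical subsolutions yields a subsolution. -/
theorem IsViscositySubsolution.glue (hn : 0 < n) (hG : IsAdmissibleOperator 𝒞 G) (hΩ : IsOpen Ω)
    (hu : IsViscositySubsolution 𝒞 G f Ω u) (hv : UpperSemicontinuousOn v Ω)
    (hlt : ∀ z ∈ Ω, v z < ⊤) (hle : ∀ z ∈ Ω, u z ≤ v z)
    (h : ∀ z ∈ Ω, v z = u z ∨ ∃ χ : Cn n → ℝ, ContDiffAt ℝ 2 χ z ∧ (χ z : EReal) = v z ∧
      (∀ᶠ y in 𝓝 z, (χ y : EReal) ≤ v y) ∧ complexHessian χ z ∈ closure 𝒞 ∧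
      f z ≤ G (complexHessian χ z)) : IsViscositySubsolution 𝒞 G f Ω v where
  upperSemicontinuousOn := hv
  lt_top := hlt
  proper := by
    obtain ⟨z, hz, hne⟩ := hu.proper
    exact ⟨z, hz, ((bot_lt_iff_ne_bot.2 hne).trans_le (hle z hz)).ne'⟩
  le_operator z₀ hz₀ ψ hψ := by
    rcases h z₀ hz₀ with heq | ⟨χ, hχ, heq, hχv, hmem, hfG⟩
    · refine hu.le_operator z₀ hz₀ ψ ⟨hψ.1, hψ.2.1.trans heq, ?_⟩
      filter_upwards [hψ.2.2, hΩ.mem_nhds hz₀] with y hy hyΩ using (hle y hyΩ).trans hy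
    · have hpsd := posSemidef_complexHessian_sub hχ hψ.1
        (EReal.coe_eq_coe_iff.1 (heq.trans hψ.2.1.symm)) (by
          filter_upwards [hχv, hψ.2.2] with y h1 h2 using EReal.coe_le_coe_iff.1 (h1.trans h2))
      obtain ⟨h1, h2⟩ := hG.add_posSemidef hn hmem hpsd
      rw [add_sub_cancel] at h1 h2
      exact ⟨h1, hfG.trans h2⟩

theorem upperSemicontinuousOn_of_coe {w : Cn n → ℝ}
    (hw : UpperSemicontinuousOn (fun z => (w z : EReal)) Ω) : UpperSemicontinuousOn w Ω := by
  intro z hz c hc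
  filter_upwards [hw z hz c (EReal.coe_lt_coe_iff.2 hc)] with y hy
  exact EReal.coe_lt_coe_iff.1 hy

/-- The test function for the envelope need not touch any member of `F`. Adding `ρ‖y - z₀‖²` makes
the contact strict, so a member nearly reaching the supremum close to `z₀` is touched by a vertical
translate at a nearby point. -/
theorem exists_near_touching (hΩ : IsOpen Ω) {F : Set (Cn n → ℝ)}
    (hF : ∀ v ∈ F, IsViscositySubsolution 𝒞 G f Ω fun z => (v z : EReal)) {z₀ : Cn n}
    {ψ : Cn n → ℝ} (hz₀ : z₀ ∈ Ω)
    (hψ : TouchesFromAbove ψ (upperEnvelope Ω fun z => ⨆ v ∈ F, (v z : EReal)) z₀) {ρ : ℝ}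
    (hρ : 0 < ρ) :
    ∃ y ∈ Ω, dist y z₀ < ρ ∧
      complexHessian ψ y + ρ • (1 : Matrix (Fin n) (Fin n) ℂ) ∈ closure 𝒞 ∧
      f y ≤ G (complexHessian ψ y + ρ • (1 : Matrix (Fin n) (Fin n) ℂ)) := by
  set S := upperEnvelope Ω fun z => ⨆ v ∈ F, (v z : EReal) with hS
  obtain ⟨hψ2, hψeq, hψle⟩ := hψ
  obtain ⟨r', hr', hball⟩ := Metric.eventually_nhds_iff_ball.1
    (((hψ2.eventually (by simp)).and hψle).and (hΩ.mem_nhds hz₀))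
  set r := min r' ρ / 2 with hr
  have hr0 : 0 < r := by positivity
  have hrr' : r < r' := by
    have h1 := min_le_left r' ρ
    have h2 : 0 < min r' ρ := by positivity
    linarith
  have hrρ : r < ρ := by
    have h1 := min_le_right r' ρ
    have h2 : 0 < min r' ρ := by positivity
    linarith
  have hcb : ∀ y ∈ Metric.closedBall z₀ r, (ContDiffAt ℝ 2 ψ y ∧ S y ≤ ψ y) ∧ y ∈ Ω :=
    fun y hy => hball y (Metric.closedBall_subset_ball hrr' hy)
  set P : Cn n → ℝ := fun y => ψ y + (ρ * ‖y - z₀‖ ^ 2 + 0) with hP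
  have hPc : ∀ y ∈ Metric.closedBall z₀ r, ContDiffAt ℝ 2 P y := fun y hy =>
    (hcb y hy).1.1.add (contDiff_const_add_norm_sub_sq _ _ _).contDiffAt
  have hz₀b : z₀ ∈ Metric.closedBall z₀ r := Metric.mem_closedBall_self hr0.le
  have hκ : 0 < ρ * r ^ 2 / 4 := by positivity
  have hPz₀ : P z₀ = ψ z₀ := by simp [hP]
  have hev₁ : ∀ᶠ y in 𝓝 z₀, P y < ψ z₀ + ρ * r ^ 2 / 4 :=
    (hPc z₀ hz₀b).continuousAt.eventually (gt_mem_nhds (by rw [hPz₀]; linarith))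
  have hfreq : ∃ᶠ y in 𝓝[Ω] z₀,
      ((ψ z₀ - ρ * r ^ 2 / 4 : ℝ) : EReal) < ⨆ v ∈ F, (v y : EReal) := by
    intro hnot
    have h1 : S z₀ ≤ ((ψ z₀ - ρ * r ^ 2 / 4 : ℝ) : EReal) :=
      upperEnvelope_le_of_eventually (hnot.mono fun y hy => not_lt.1 hy)
    rw [← hψeq, EReal.coe_le_coe_iff] at h1
    linarith
  have hev₂ : ∀ᶠ y in 𝓝[Ω] z₀, P y < ψ z₀ + ρ * r ^ 2 / 4 ∧ y ∈ Metric.closedBall z₀ r :=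
    mem_nhdsWithin_of_mem_nhds (hev₁.and (Metric.closedBall_mem_nhds z₀ hr0))
  obtain ⟨y₁, hy₁, hy₁P, hy₁b⟩ := (hfreq.and_eventually hev₂).exists
  obtain ⟨v, hvF, hvy₁⟩ := lt_biSup_iff.1 hy₁
  rw [EReal.coe_lt_coe_iff] at hvy₁
  have hvS : ∀ y ∈ Ω, (v y : EReal) ≤ S y := fun y hy =>
    (le_biSup (fun v : Cn n → ℝ => (v y : EReal)) hvF).trans
      (le_upperEnvelope (u := fun z => ⨆ v ∈ F, (v z : EReal)) hy)
  have husc : UpperSemicontinuousOn (fun y => v y + -P y) (Metric.closedBall z₀ r) := by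
    refine UpperSemicontinuousOn.add ?_ ?_
    · exact (upperSemicontinuousOn_of_coe (hF v hvF).upperSemicontinuousOn).mono
        fun y hy => (hcb y hy).2
    · have : ContinuousOn (fun y => -P y) (Metric.closedBall z₀ r) := fun y hy =>
        (hPc y hy).continuousAt.neg.continuousWithinAt
      exact this.upperSemicontinuousOn
  obtain ⟨y, hyb, hmax⟩ := husc.exists_isMaxOn ⟨z₀, hz₀b⟩ (isCompact_closedBall z₀ r)
  have hyval : v y₁ + -P y₁ ≤ v y + -P y := hmax hy₁b
  have hvψ : v y ≤ ψ y :=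
    EReal.coe_le_coe_iff.1 ((hvS y (hcb y hyb).2).trans (hcb y hyb).1.2)
  -- At `y₁` the difference `v - P` exceeds `-ρ r² / 2`, whereas on the sphere `v ≤ ψ` makes it at
  -- most `-ρ r²`.
  have hyint : dist y z₀ < r := by
    refine lt_of_le_of_ne hyb fun heq => ?_
    have h1 : P y = ψ y + ρ * r ^ 2 := by simp only [hP]; rw [← dist_eq_norm, heq, add_zero]
    linarith
  have htouch : TouchesFromAbove (fun x => ψ x + (ρ * ‖x - z₀‖ ^ 2 + (v y - P y)))
      (fun z => (v z : EReal)) y := by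
    refine ⟨(hcb y hyb).1.1.add (contDiff_const_add_norm_sub_sq _ _ _).contDiffAt, ?_, ?_⟩
    · rw [EReal.coe_eq_coe_iff]; simp only [hP]; ring
    · filter_upwards [Metric.isOpen_ball.mem_nhds (Metric.mem_ball.2 hyint)] with x hx
      have h1 : v x + -P x ≤ v y + -P y := hmax (Metric.ball_subset_closedBall hx)
      rw [EReal.coe_le_coe_iff]
      simp only [hP] at h1 ⊢
      linarith
  have := (hF v hvF).le_operator y (hcb y hyb).2 _ htouch
  rw [complexHessian_add_norm_sub_sq (hcb y hyb).1.1] at this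
  exact ⟨y, (hcb y hyb).2, hyint.trans hrρ, this⟩

/-- The upper semicontinuous envelope of a supremum of subsolutions is a subsolution. -/
theorem isViscositySubsolution_upperEnvelope_iSup (hG : IsAdmissibleOperator 𝒞 G) (hΩ : IsOpen Ω)
    (hf : ContinuousOn f Ω) {F : Set (Cn n → ℝ)} (hne : F.Nonempty) (hΩne : Ω.Nonempty)
    (hF : ∀ v ∈ F, IsViscositySubsolution 𝒞 G f Ω fun z => (v z : EReal))
    (hlt : ∀ z ∈ Ω, upperEnvelope Ω (fun z => ⨆ v ∈ F, (v z : EReal)) z < ⊤) :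
    IsViscositySubsolution 𝒞 G f Ω (upperEnvelope Ω fun z => ⨆ v ∈ F, (v z : EReal)) where
  upperSemicontinuousOn := upperSemicontinuous_upperEnvelope.upperSemicontinuousOn _
  lt_top := hlt
  proper := by
    obtain ⟨v, hv⟩ := hne
    obtain ⟨z, hz⟩ := hΩne
    refine ⟨z, hz, ((EReal.bot_lt_coe (v z)).trans_le ?_).ne'⟩
    exact (le_biSup (fun v : Cn n → ℝ => (v z : EReal)) hv).trans
      (le_upperEnvelope (u := fun z => ⨆ v ∈ F, (v z : EReal)) hz)
  le_operator z₀ hz₀ ψ hψ := by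
    choose y hyΩ hyd hymem hyf using fun k : ℕ =>
      exists_near_touching hΩ hF hz₀ hψ (Nat.one_div_pos_of_nat (α := ℝ) (n := k))
    have hρ := tendsto_one_div_add_atTop_nhds_zero_nat (𝕜 := ℝ)
    have hy : Tendsto y atTop (𝓝 z₀) :=
      tendsto_iff_dist_tendsto_zero.2
        (squeeze_zero (fun _ => dist_nonneg) (fun k => (hyd k).le) hρ)
    have hA : Tendsto (fun k : ℕ => complexHessian ψ (y k) +
        (1 / ((k : ℝ) + 1)) • (1 : Matrix (Fin n) (Fin n) ℂ)) atTop
        (𝓝 (complexHessian ψ z₀)) := by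
      have h1 := ((continuousAt_complexHessian hψ.1).tendsto.comp hy).add
        (hρ.smul_const (1 : Matrix (Fin n) (Fin n) ℂ))
      rwa [zero_smul, add_zero] at h1
    have hmem := isClosed_closure.mem_of_tendsto hA (Eventually.of_forall hymem)
    refine ⟨hmem, ?_⟩
    have hGA := (hG.continuousOn _ hmem).tendsto.comp
      (tendsto_nhdsWithin_iff.2 ⟨hA, Eventually.of_forall hymem⟩)
    have hfy := ((hf z₀ hz₀).continuousAt (hΩ.mem_nhds hz₀)).tendsto.comp hy
    exact le_of_tendsto_of_tendsto' hfy hGA hyf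

theorem complexHessian_const (c : ℝ) (z : Cn n) : complexHessian (fun _ => c) z = 0 := by
  ext j k
  simp [complexHessian]

/-- Constants are supersolutions. -/
theorem isViscositySupersolution_const (hn : 0 < n) (hG : IsAdmissibleOperator 𝒞 G)
    (hf : ∀ z ∈ Ω, ∀ A ∈ closure 𝒞 \ 𝒞, G A ≤ f z) (hΩ : Ω.Nonempty) (M : ℝ) :
    IsViscositySupersolution 𝒞 G f Ω fun _ => (M : EReal) where
  lowerSemicontinuousOn := lowerSemicontinuous_const.lowerSemicontinuousOn _
  bot_lt _ _ := EReal.bot_lt_coe M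
  proper := hΩ.imp fun _ hz => ⟨hz, EReal.coe_ne_top M⟩
  operator_le z₀ hz₀ ψ hψ hmem := by
    have h1 := posSemidef_complexHessian_sub hψ.1 (contDiff_const (c := M)).contDiffAt
      (EReal.coe_eq_coe_iff.1 hψ.2.1) (hψ.2.2.mono fun y hy => EReal.coe_le_coe_iff.1 hy)
    have h2 := (hG.add_posSemidef hn hmem h1).2
    rw [add_sub_cancel, complexHessian_const] at h2
    exact h2.trans (hf z₀ hz₀ 0 ⟨hG.zero_mem_closure, hG.zero_notMem hn⟩)

/-- Below any level there is a uniformly bounded strictly plurisubharmonic classical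
subsolution. -/
theorem exists_smooth_subsolution (hn : 0 < n) (hG : IsAdmissibleOperator 𝒞 G)
    (hΩb : Bornology.IsBounded Ω) (hf : ContinuousOn f (closure Ω)) (c : ℝ) :
    ∃ (χ : Cn n → ℝ) (m : ℝ), ContDiff ℝ 2 χ ∧ (∀ z ∈ Ω, m ≤ χ z ∧ χ z ≤ c) ∧
      ∀ z ∈ Ω, complexHessian χ z ∈ closure 𝒞 ∧ f z ≤ G (complexHessian χ z) := by
  obtain ⟨C, hC, hmono⟩ := hG.exists_monotone_const hn
  obtain ⟨D, hD⟩ := hΩb.isCompact_closure.bddAbove_image hf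
  obtain ⟨R, hR⟩ := hΩb.exists_norm_le
  -- Since `G 0 ≥ 0`, the Hessian `K • 1` gives `G ≥ C K = |D|`, which dominates `f`.
  set K := |D| / C with hK
  have hK0 : 0 ≤ K := by positivity
  have hCK : C * K = |D| := by rw [hK]; field_simp
  set χ : Cn n → ℝ := fun z => 0 + (K * ‖z - 0‖ ^ 2 + (c - K * R ^ 2)) with hχ
  refine ⟨χ, c - K * R ^ 2,
    contDiff_const.add (contDiff_const_add_norm_sub_sq _ _ _), fun z hz => ?_, fun z hz => ?_⟩
  · have h1 : ‖z‖ ^ 2 ≤ R ^ 2 := by have := hR z hz; gcongr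
    have h2 : K * ‖z‖ ^ 2 ≤ K * R ^ 2 := by gcongr
    have h3 : 0 ≤ K * ‖z‖ ^ 2 := by positivity
    simp only [hχ, sub_zero]
    constructor <;> linarith
  · rw [hχ, complexHessian_add_norm_sub_sq contDiff_const.contDiffAt, complexHessian_const]
    obtain ⟨h1, h2⟩ := hmono 0 hG.zero_mem_closure 0 Matrix.PosSemidef.zero K hK0
    rw [add_zero] at h1 h2
    refine ⟨h1, ?_⟩
    have h3 := hG.nonneg_of_mem_closure hG.zero_mem_closure
    have h4 : f z ≤ D := hD ⟨z, subset_closure hz, rfl⟩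
    linarith [le_abs_self D]

theorem isViscositySubsolution_of_contDiff (hn : 0 < n) (hG : IsAdmissibleOperator 𝒞 G)
    (hΩ : Ω.Nonempty) {χ : Cn n → ℝ} (hχ : ContDiff ℝ 2 χ)
    (h : ∀ z ∈ Ω, complexHessian χ z ∈ closure 𝒞 ∧ f z ≤ G (complexHessian χ z)) :
    IsViscositySubsolution 𝒞 G f Ω fun z => (χ z : EReal) where
  upperSemicontinuousOn :=
    (continuous_coe_real_ereal.comp hχ.continuous).upperSemicontinuous.upperSemicontinuousOn _
  lt_top z _ := EReal.coe_lt_top (χ z)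
  proper := hΩ.imp fun z hz => ⟨hz, EReal.coe_ne_bot (χ z)⟩
  le_operator z₀ hz₀ ψ hψ := by
    have hpsd := posSemidef_complexHessian_sub hχ.contDiffAt hψ.1
      (EReal.coe_eq_coe_iff.1 hψ.2.1.symm) (hψ.2.2.mono fun y hy => EReal.coe_le_coe_iff.1 hy)
    obtain ⟨h1, h2⟩ := hG.add_posSemidef hn (h z₀ hz₀).1 hpsd
    rw [add_sub_cancel] at h1 h2
    exact ⟨h1, (h z₀ hz₀).2.trans h2⟩

/-- The envelope is upper semicontinuous on the whole space, boundary points included, so replacing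
a function by it does not raise the boundary values. -/
theorem upperEnvelope_upperEnvelope_le (z : Cn n) :
    upperEnvelope Ω (upperEnvelope Ω u) z ≤ upperEnvelope Ω u z :=
  le_of_forall_gt_imp_ge_of_dense fun c hc => upperEnvelope_le_of_eventually
    (mem_nhdsWithin_of_mem_nhds ((upperSemicontinuous_upperEnvelope z c hc).mono fun _ h => h.le))

theorem le_lowerEnvelope_lowerEnvelope (z : Cn n) :
    lowerEnvelope Ω u z ≤ lowerEnvelope Ω (lowerEnvelope Ω u) z :=
  le_of_forall_lt_imp_le_of_dense fun c hc => le_lowerEnvelope_of_eventually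
    (mem_nhdsWithin_of_mem_nhds ((lowerSemicontinuous_lowerEnvelope z c hc).mono fun _ h => h.le))

theorem envelopes_of_tendsto {w : Cn n → ℝ} {z : Cn n} {L : ℝ} (h : Tendsto w (𝓝[Ω] z) (𝓝 L)) :
    upperEnvelope Ω (fun z => (w z : EReal)) z ≤ L ∧
      (L : EReal) ≤ lowerEnvelope Ω (fun z => (w z : EReal)) z := by
  have h' : Tendsto (fun z => (w z : EReal)) (𝓝[Ω] z) (𝓝 (L : EReal)) :=
    (continuous_coe_real_ereal.tendsto L).comp h
  exact ⟨le_of_forall_gt_imp_ge_of_dense fun c hc => upperEnvelope_le_of_eventually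
      ((h'.eventually (gt_mem_nhds hc)).mono fun _ h => h.le),
    le_of_forall_lt_imp_le_of_dense fun c hc => le_lowerEnvelope_of_eventually
      ((h'.eventually (lt_mem_nhds hc)).mono fun _ h => h.le)⟩

theorem coe_toReal_of_bounds {w : EReal} {m M : ℝ} (h : (m : EReal) ≤ w ∧ w ≤ M) :
    (w.toReal : EReal) = w :=
  EReal.coe_toReal (h.2.trans_lt (EReal.coe_lt_top M)).ne ((EReal.bot_lt_coe m).trans_le h.1).ne'

theorem toReal_mem_perronFamily (hΩ : IsOpen Ω) {φsub φsup w : Cn n → EReal}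
    (hw : IsViscositySubsolution 𝒞 G f Ω w) {m M : ℝ}
    (hb : ∀ z ∈ Ω, (m : EReal) ≤ w z ∧ w z ≤ M)
    (hle : ∀ z ∈ Ω, φsub z ≤ w z ∧ w z ≤ φsup z) :
    (fun z => (w z).toReal) ∈ perronFamily 𝒞 G f Ω φsub φsup := by
  have hcoe : ∀ z ∈ Ω, ((w z).toReal : EReal) = w z := fun z hz => coe_toReal_of_bounds (hb z hz)
  refine ⟨⟨max |m| |M|, fun z hz => ?_⟩, hw.congr hΩ fun z hz => (hcoe z hz).symm,
    fun z hz => ?_⟩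
  · have h := hb z hz
    rw [← hcoe z hz, EReal.coe_le_coe_iff, EReal.coe_le_coe_iff] at h
    exact abs_le_max_abs_abs h.1 h.2
  · rw [hcoe z hz]; exact hle z hz

theorem le_perronEnvelope (hΩ : IsOpen Ω) {φsub φsup w : Cn n → EReal}
    (hw : IsViscositySubsolution 𝒞 G f Ω w) {m M : ℝ}
    (hb : ∀ z ∈ Ω, (m : EReal) ≤ w z ∧ w z ≤ M)
    (hle : ∀ z ∈ Ω, φsub z ≤ w z ∧ w z ≤ φsup z) :
    ∀ z ∈ Ω, w z ≤ perronEnvelope 𝒞 G f Ω φsub φsup z := by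
  intro z hz
  have h := le_biSup (fun v : Cn n → ℝ => (v z : EReal)) (toReal_mem_perronFamily hΩ hw hb hle)
  simp only [coe_toReal_of_bounds (hb z hz)] at h
  exact h

/-- A strict classical subsolution stays one after a small concave quadratic perturbation. -/
theorem exists_perturbed_subsolution (hG : IsAdmissibleOperator 𝒞 G) {ψ : Cn n → ℝ} {z₀ : Cn n}
    (hψ : ContDiffAt ℝ 2 ψ z₀) (hf : ContinuousAt f z₀) (hmem : complexHessian ψ z₀ ∈ 𝒞)
    (hlt : f z₀ < G (complexHessian ψ z₀)) :
    ∃ η : ℝ, 0 < η ∧ ∀ᶠ z in 𝓝 z₀,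
      complexHessian ψ z + (-η) • (1 : Matrix (Fin n) (Fin n) ℂ) ∈ closure 𝒞 ∧
        f z ≤ G (complexHessian ψ z + (-η) • (1 : Matrix (Fin n) (Fin n) ℂ)) := by
  set H : Cn n × ℝ → Matrix (Fin n) (Fin n) ℂ := fun q =>
    complexHessian ψ q.1 + (-q.2) • (1 : Matrix (Fin n) (Fin n) ℂ) with hH
  obtain ⟨U, hU, hUC⟩ := hG.isOpen
  have hH0 : H (z₀, 0) = complexHessian ψ z₀ := by simp [hH]
  have hHc : Tendsto H (𝓝 (z₀, 0)) (𝓝 (complexHessian ψ z₀)) := by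
    rw [← hH0]
    refine ContinuousAt.add ?_ ?_
    · exact ContinuousAt.comp (f := Prod.fst) (x := (z₀, (0 : ℝ))) (continuousAt_complexHessian hψ)
        continuousAt_fst
    · exact (continuous_snd.neg.smul continuous_const).continuousAt
  have hfst : Tendsto (fun q : Cn n × ℝ => q.1) (𝓝 (z₀, 0)) (𝓝 z₀) :=
    continuous_fst.tendsto (z₀, (0 : ℝ))
  have hmem' : ∀ᶠ q in 𝓝 (z₀, (0 : ℝ)), H q ∈ 𝒞 := by
    have hzU : complexHessian ψ z₀ ∈ U := (hUC ▸ hmem : complexHessian ψ z₀ ∈ U ∩ _).1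
    filter_upwards [hHc.eventually (hU.mem_nhds hzU),
      hfst.eventually (hψ.eventually (by simp))] with q hq hq'
    rw [hUC]
    refine ⟨hq, (isHermitian_complexHessian hq').add ?_⟩
    exact Matrix.IsHermitian.smul Matrix.isHermitian_one (IsSelfAdjoint.all _)
  have hGH : Tendsto (fun q => G (H q)) (𝓝 (z₀, (0 : ℝ))) (𝓝 (G (complexHessian ψ z₀))) :=
    (hG.continuousOn _ (subset_closure hmem)).tendsto.comp
      (tendsto_nhdsWithin_iff.2 ⟨hHc, hmem'.mono fun q hq => subset_closure hq⟩)
  have hev := hmem'.and ((hf.tendsto.comp hfst).eventually_lt hGH hlt)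
  obtain ⟨r, hr, hball⟩ := Metric.eventually_nhds_iff_ball.1 hev
  refine ⟨r / 2, half_pos hr, ?_⟩
  filter_upwards [Metric.ball_mem_nhds z₀ hr] with z hz
  have hzq : (z, r / 2) ∈ Metric.ball (z₀, (0 : ℝ)) r := by
    rw [← ball_prod_same]
    refine ⟨hz, ?_⟩
    rw [Metric.mem_ball, dist_zero_right, Real.norm_eq_abs, abs_of_pos (half_pos hr)]
    exact half_lt_self hr
  obtain ⟨h1, h2⟩ := hball _ hzq
  exact ⟨subset_closure h1, h2.le⟩

/-- The lower semicontinuous envelope of the Perron envelope is a supersolution. -/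
theorem isViscositySupersolution_lowerEnvelope_perronEnvelope (hn : 0 < n)
    (hG : IsAdmissibleOperator 𝒞 G) (hΩ : IsOpen Ω) (hΩne : Ω.Nonempty) (hf : ContinuousOn f Ω)
    (hf_bdry : ∀ z ∈ Ω, ∀ A ∈ closure 𝒞 \ 𝒞, G A ≤ f z) {φsub φsup : Cn n → EReal}
    (hsup : IsViscositySupersolution 𝒞 G f Ω φsup)
    (hE : IsViscositySubsolution 𝒞 G f Ω (perronEnvelope 𝒞 G f Ω φsub φsup)) {m M : ℝ}
    (hb : ∀ z ∈ Ω, (m : EReal) ≤ perronEnvelope 𝒞 G f Ω φsub φsup z ∧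
      perronEnvelope 𝒞 G f Ω φsub φsup z ≤ M)
    (hle : ∀ z ∈ Ω, φsub z ≤ perronEnvelope 𝒞 G f Ω φsub φsup z ∧
      perronEnvelope 𝒞 G f Ω φsub φsup z ≤ φsup z) :
    IsViscositySupersolution 𝒞 G f Ω (lowerEnvelope Ω (perronEnvelope 𝒞 G f Ω φsub φsup)) where
  lowerSemicontinuousOn := lowerSemicontinuous_lowerEnvelope.lowerSemicontinuousOn _
  bot_lt z _ := (EReal.bot_lt_coe m).trans_le (le_lowerEnvelope_of_eventually
    (by filter_upwards [self_mem_nhdsWithin] with y hy using (hb y hy).1))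
  proper := by
    obtain ⟨z, hz⟩ := hΩne
    exact ⟨z, hz, (((lowerEnvelope_le hz).trans (hb z hz).2).trans_lt (EReal.coe_lt_top M)).ne⟩
  operator_le z₀ hz₀ ψ hψ hcl := by
    set E := perronEnvelope 𝒞 G f Ω φsub φsup with hEdef
    by_contra! hlt
    obtain ⟨hψ2, hψeq, hψle⟩ := hψ
    -- On the boundary of the cone `G ≤ f`; the strict excess therefore places the Hessian in the
    -- open cone, where small perturbations are allowed.
    have hmem : complexHessian ψ z₀ ∈ 𝒞 := by
      by_contra h
      exact absurd (hf_bdry z₀ hz₀ _ ⟨hcl, h⟩) (not_le.2 hlt)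
    have hψE : ∀ᶠ y in 𝓝 z₀, (ψ y : EReal) ≤ E y := by
      filter_upwards [hψle, hΩ.mem_nhds hz₀] with y hy hyΩ using hy.trans (lowerEnvelope_le hyΩ)
    -- With equality, `ψ` would touch the supersolution `φsup` from below. The strict gap is the
    -- room for the bump.
    have hψsup : (ψ z₀ : EReal) < φsup z₀ := by
      refine lt_of_le_of_ne (hψE.self_of_nhds.trans (hle z₀ hz₀).2) fun heq => ?_
      refine absurd (hsup.operator_le z₀ hz₀ ψ ⟨hψ2, heq, ?_⟩ hcl) (not_le.2 hlt)
      filter_upwards [hψE, hΩ.mem_nhds hz₀] with y hy hyΩ using hy.trans (hle y hyΩ).2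
    obtain ⟨c, hc₁, hc₂⟩ := EReal.lt_iff_exists_real_btwn.1 hψsup
    rw [EReal.coe_lt_coe_iff] at hc₁
    obtain ⟨η, hη, hpert⟩ := exists_perturbed_subsolution hG hψ2
      ((hf z₀ hz₀).continuousAt (hΩ.mem_nhds hz₀)) hmem hlt
    have hφc : ∀ᶠ y in 𝓝 z₀, (c : EReal) < φsup y := by
      have := hsup.lowerSemicontinuousOn z₀ hz₀ c hc₂
      rwa [hΩ.nhdsWithin_eq hz₀] at this
    have hψc : ∀ᶠ y in 𝓝 z₀, ψ y < (ψ z₀ + c) / 2 :=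
      hψ2.continuousAt.eventually (gt_mem_nhds (by linarith))
    obtain ⟨r, hr, hball⟩ := Metric.eventually_nhds_iff_ball.1
      ((hpert.and ((hψ2.eventually (by simp)).and hψE)).and ((hφc.and hψc).and (hΩ.mem_nhds hz₀)))
    -- The first bound keeps the bump below `c`, hence below `φsup`; the second makes it fall below
    -- `ψ ≤ E` beyond radius `r / 2`, where `η‖z - z₀‖²` exceeds `η r² / 4`.
    set δ := min ((c - ψ z₀) / 2) (η * r ^ 2 / 8) with hδ
    have hδ0 : 0 < δ := lt_min (by linarith) (by positivity)
    have hδ₁ : δ ≤ (c - ψ z₀) / 2 := min_le_left _ _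
    have hδ₂ : δ ≤ η * r ^ 2 / 8 := min_le_right _ _
    set χ : Cn n → ℝ := fun z => ψ z + (-η * ‖z - z₀‖ ^ 2 + δ) with hχ
    have hχ2 : ∀ z ∈ Metric.ball z₀ r, ContDiffAt ℝ 2 χ z := fun z hz =>
      (hball z hz).1.2.1.add (contDiff_const_add_norm_sub_sq _ _ _).contDiffAt
    have hχsup : ∀ z ∈ Metric.ball z₀ r, χ z ≤ c := by
      intro z hz
      have h1 := (hball z hz).2.1.2
      have h2 : 0 ≤ η * ‖z - z₀‖ ^ 2 := by positivity
      simp only [hχ]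
      linarith
    have hχE : ∀ z ∈ Metric.ball z₀ r, r / 2 < dist z z₀ → (χ z : EReal) ≤ E z := by
      intro z hz hzr
      refine le_trans (EReal.coe_le_coe_iff.2 ?_) (hball z hz).1.2.2
      rw [dist_eq_norm] at hzr
      have h1 : (r / 2) ^ 2 ≤ ‖z - z₀‖ ^ 2 := by gcongr
      have h2 : η * (r / 2) ^ 2 ≤ η * ‖z - z₀‖ ^ 2 := by gcongr
      have h3 : 0 < η * r ^ 2 := by positivity
      simp only [hχ]
      linarith
    classical
    set w : Cn n → EReal := fun z =>
      if z ∈ Metric.ball z₀ r then max (E z) (χ z : EReal) else E z with hw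
    have hwball : ∀ z ∈ Metric.ball z₀ r, w z = max (E z) (χ z) := fun z hz => if_pos hz
    have hwE : ∀ z, r / 2 < dist z z₀ → w z = E z := by
      intro z hz
      by_cases h : z ∈ Metric.ball z₀ r
      · rw [hwball z h, max_eq_left (hχE z h hz)]
      · exact if_neg h
    have hEw : ∀ z, E z ≤ w z := by
      intro z
      by_cases h : z ∈ Metric.ball z₀ r
      · rw [hwball z h]; exact le_max_left _ _
      · exact (if_neg h).ge
    have hwcases : ∀ z, w z = E z ∨ z ∈ Metric.ball z₀ r ∧ w z = χ z := by
      intro z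
      by_cases h : z ∈ Metric.ball z₀ r
      · rw [hwball z h]
        rcases max_choice (E z) (χ z : EReal) with h' | h'
        · exact Or.inl h'
        · exact Or.inr ⟨h, h'⟩
      · exact Or.inl (if_neg h)
    have hwusc : UpperSemicontinuousOn w Ω := by
      intro z hz b hzb
      by_cases h : z ∈ Metric.ball z₀ r
      · rw [hwball z h, max_lt_iff] at hzb
        have h1 : ∀ᶠ y in 𝓝[Ω] z, (χ y : EReal) < b :=
          mem_nhdsWithin_of_mem_nhds ((continuous_coe_real_ereal.continuousAt.comp
            (hχ2 z h).continuousAt).eventually (gt_mem_nhds hzb.2))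
        filter_upwards [hE.upperSemicontinuousOn z hz b hzb.1, h1,
          mem_nhdsWithin_of_mem_nhds (Metric.isOpen_ball.mem_nhds h)] with y hy hy' hyb
        rw [hwball y hyb]
        exact max_lt hy hy'
      · have hzr : r / 2 < dist z z₀ := by
          rw [Metric.mem_ball, not_lt] at h; linarith
        rw [hwE z hzr] at hzb
        have h1 : ∀ᶠ y in 𝓝[Ω] z, r / 2 < dist y z₀ :=
          mem_nhdsWithin_of_mem_nhds ((continuous_id.dist continuous_const).continuousAt.eventually
            (lt_mem_nhds hzr))
        filter_upwards [hE.upperSemicontinuousOn z hz b hzb, h1] with y hy hy'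
        rwa [hwE y hy']
    have hwM : ∀ z ∈ Ω, w z ≤ ((max M c : ℝ) : EReal) := by
      intro z hz
      rcases hwcases z with h | ⟨h, h'⟩
      · rw [h]
        exact (hb z hz).2.trans (EReal.coe_le_coe_iff.2 (le_max_left _ _))
      · rw [h', EReal.coe_le_coe_iff]
        exact (hχsup z h).trans (le_max_right _ _)
    have hwsub : IsViscositySubsolution 𝒞 G f Ω w := by
      refine hE.glue hn hG hΩ hwusc (fun z hz => (hwM z hz).trans_lt (EReal.coe_lt_top _))
        (fun z _ => hEw z) fun z hz => (hwcases z).imp_right fun h => ?_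
      refine ⟨χ, hχ2 z h.1, h.2.symm, ?_, ?_⟩
      · filter_upwards [Metric.isOpen_ball.mem_nhds h.1] with y hy
        rw [hwball y hy]; exact le_max_right _ _
      · rw [hχ, complexHessian_add_norm_sub_sq (hball z h.1).1.2.1]
        exact (hball z h.1).1.1
    have hwle : ∀ z ∈ Ω, φsub z ≤ w z ∧ w z ≤ φsup z := by
      intro z hz
      refine ⟨(hle z hz).1.trans (hEw z), ?_⟩
      rcases hwcases z with h | ⟨h, h'⟩
      · rw [h]; exact (hle z hz).2
      · rw [h']
        exact (EReal.coe_le_coe_iff.2 (hχsup z h)).trans (hball z h).2.1.1.le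
    have hwE' := le_perronEnvelope hΩ hwsub
      (fun z hz => ⟨(hb z hz).1.trans (hEw z), hwM z hz⟩) hwle
    have hfinal : ((ψ z₀ + δ / 2 : ℝ) : EReal) ≤ lowerEnvelope Ω E z₀ := by
      refine le_lowerEnvelope_of_eventually ?_
      have hχz₀ : χ z₀ = ψ z₀ + δ := by simp [hχ]
      have h1 : ∀ᶠ y in 𝓝 z₀, ψ z₀ + δ / 2 < χ y :=
        (hχ2 z₀ (Metric.mem_ball_self hr)).continuousAt.eventually
          (lt_mem_nhds (by rw [hχz₀]; linarith))
      filter_upwards [mem_nhdsWithin_of_mem_nhds (h1.and (Metric.ball_mem_nhds z₀ hr)),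
        self_mem_nhdsWithin] with y hy hyΩ
      refine (EReal.coe_le_coe_iff.2 hy.1.le).trans (le_trans ?_ (hwE' y hyΩ))
      rw [hwball y hy.2]
      exact le_max_right _ _
    rw [← hψeq, EReal.coe_le_coe_iff] at hfinal
    linarith

end Perron

/-! ### Existence, boundary values and uniqueness. -/

theorem mainTheorem5 (n : ℕ) (hn : 0 < n)
    (𝒞 : Set (Matrix (Fin n) (Fin n) ℂ)) (G : Matrix (Fin n) (Fin n) ℂ → ℝ)
    (hG : IsAdmissibleOperator 𝒞 G)
    (Ω : Set (Cn n)) (hΩ_open : IsOpen Ω) (hΩ_conn : IsConnected Ω)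
    (hΩ_bdd : Bornology.IsBounded Ω)
    (f : Cn n → ℝ) (hf_cont : ContinuousOn f (closure Ω)) (hf_pos : ∀ z ∈ closure Ω, 0 < f z)
    (hf_bdry : ∀ z ∈ Ω, ∀ A ∈ closure 𝒞 \ 𝒞, G A ≤ f z)
    (φ : Cn n → ℝ) (hφ : ContinuousOn φ (frontier Ω))
    (φsub φsup : Cn n → EReal)
    (hsub : IsViscositySubsolution 𝒞 G f Ω φsub)
    (hsup : IsViscositySupersolution 𝒞 G f Ω φsup)
    (hle : ∀ z ∈ Ω, φsub z ≤ φsup z)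
    (hsub_bdry : ∀ ζ ∈ frontier Ω, lowerEnvelope Ω φsub ζ = (φ ζ : EReal))
    (hsup_bdry : ∀ ζ ∈ frontier Ω, upperEnvelope Ω φsup ζ = (φ ζ : EReal)) :
    ∃ u : Cn n → ℝ,
      (∀ z ∈ Ω, (u z : EReal) = perronEnvelope 𝒞 G f Ω φsub φsup z) ∧
      IsViscositySolution 𝒞 G f Ω u ∧ HasBoundaryValue Ω u φ ∧
      ∀ w : Cn n → ℝ, IsViscositySolution 𝒞 G f Ω w → HasBoundaryValue Ω w φ →
        ∀ z ∈ Ω, w z = u z := by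
  have hΩne : Ω.Nonempty := hΩ_conn.nonempty
  have hfΩ : ContinuousOn f Ω := hf_cont.mono subset_closure
  have hcompact : IsCompact (frontier Ω) :=
    hΩ_bdd.isCompact_closure.of_isClosed_subset isClosed_frontier frontier_subset_closure
  obtain ⟨M, hM⟩ := hcompact.bddAbove_image hφ
  obtain ⟨c, hc⟩ := hcompact.bddBelow_image hφ
  have hcmp : ∀ {u v : Cn n → EReal}, IsViscositySubsolution 𝒞 G f Ω u →
      IsViscositySupersolution 𝒞 G f Ω v →
      (∀ ζ ∈ frontier Ω, upperEnvelope Ω u ζ ≤ φ ζ) →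
      (∀ ζ ∈ frontier Ω, (φ ζ : EReal) ≤ lowerEnvelope Ω v ζ) → ∀ z ∈ Ω, u z ≤ v z :=
    fun hu hv => hu.le_supersolution hn hG hΩ_open hΩ_bdd hf_cont hv
  have hlow : ∀ {w : Cn n → EReal}, (∀ z ∈ Ω, φsub z ≤ w z) →
      ∀ ζ ∈ frontier Ω, (φ ζ : EReal) ≤ lowerEnvelope Ω w ζ := fun hw ζ hζ =>
    (hsub_bdry ζ hζ).ge.trans (lowerEnvelope_mono hw ζ)
  have hupp : ∀ {w : Cn n → EReal}, (∀ z ∈ Ω, w z ≤ φsup z) →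
      ∀ ζ ∈ frontier Ω, upperEnvelope Ω w ζ ≤ φ ζ := fun hw ζ hζ =>
    (upperEnvelope_mono hw ζ).trans (hsup_bdry ζ hζ).le
  -- bounds for subsolutions below `φsup`
  have hleM : ∀ {w : Cn n → EReal}, IsViscositySubsolution 𝒞 G f Ω w →
      (∀ z ∈ Ω, w z ≤ φsup z) → ∀ z ∈ Ω, w z ≤ M := fun hw hwle =>
    hcmp hw (isViscositySupersolution_const hn hG hf_bdry hΩne M) (hupp hwle) fun ζ hζ =>
      le_lowerEnvelope_of_eventually (Eventually.of_forall fun _ =>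
        EReal.coe_le_coe_iff.2 (hM ⟨ζ, hζ, rfl⟩))
  -- an element of the Perron family
  obtain ⟨χ, m, hχ2, hχb, hχG⟩ := exists_smooth_subsolution hn hG hΩ_bdd hf_cont c
  have hχsub := isViscositySubsolution_of_contDiff (f := f) hn hG hΩne hχ2 hχG
  have hχsup : ∀ z ∈ Ω, (χ z : EReal) ≤ φsup z := hcmp hχsub hsup
    (fun ζ hζ => upperEnvelope_le_of_eventually (by
      filter_upwards [self_mem_nhdsWithin] with y hy
      exact EReal.coe_le_coe_iff.2 ((hχb y hy).2.trans (hc ⟨ζ, hζ, rfl⟩)))) (hlow hle)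
  -- The barrier `φsub` may be unbounded below or take the value `-∞`; the maximum with `χ` gives a
  -- bounded competitor, so the family is nonempty.
  set v₀ : Cn n → EReal := fun z => max (φsub z) (χ z) with hv₀
  have hv₀sub : IsViscositySubsolution 𝒞 G f Ω v₀ := by
    refine hsub.glue hn hG hΩ_open
      (hsub.upperSemicontinuousOn.sup hχsub.upperSemicontinuousOn)
      (fun z hz => max_lt (hsub.lt_top z hz) (EReal.coe_lt_top _)) (fun z _ => le_max_left _ _)
      fun z hz => ?_
    rcases max_choice (φsub z) (χ z : EReal) with h | h
    · exact Or.inl h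
    · exact Or.inr ⟨χ, hχ2.contDiffAt, h.symm, Eventually.of_forall fun y => le_max_right _ _,
        hχG z hz⟩
  have hv₀le : ∀ z ∈ Ω, φsub z ≤ v₀ z ∧ v₀ z ≤ φsup z := fun z hz =>
    ⟨le_max_left _ _, max_le (hle z hz) (hχsup z hz)⟩
  have hv₀b : ∀ z ∈ Ω, (m : EReal) ≤ v₀ z ∧ v₀ z ≤ M := fun z hz =>
    ⟨(EReal.coe_le_coe_iff.2 (hχb z hz).1).trans (le_max_right _ _),
      hleM hv₀sub (fun z hz => (hv₀le z hz).2) z hz⟩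
  set E := perronEnvelope 𝒞 G f Ω φsub φsup with hE
  have hv₀E : ∀ z ∈ Ω, v₀ z ≤ E z := le_perronEnvelope hΩ_open hv₀sub hv₀b hv₀le
  have hEsup : ∀ z ∈ Ω, E z ≤ φsup z := fun z hz => iSup₂_le fun v hv => (hv.2.2 z hz).2
  have hEM : ∀ z ∈ Ω, E z ≤ M := fun z hz => iSup₂_le fun v hv =>
    hleM hv.2.1 (fun z hz => (hv.2.2 z hz).2) z hz
  -- the Perron envelope is an upper semicontinuous subsolution
  have hSM : ∀ z ∈ Ω, upperEnvelope Ω E z ≤ M := fun z _ => upperEnvelope_le_of_eventually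
    (by filter_upwards [self_mem_nhdsWithin] with y hy using hEM y hy)
  have hSsub : IsViscositySubsolution 𝒞 G f Ω (upperEnvelope Ω E) :=
    isViscositySubsolution_upperEnvelope_iSup hG hΩ_open hfΩ
      ⟨_, toReal_mem_perronFamily hΩ_open hv₀sub hv₀b hv₀le⟩ hΩne (fun v hv => hv.2.1)
      fun z hz => (hSM z hz).trans_lt (EReal.coe_lt_top M)
  -- The barrier `φsup` is only lower semicontinuous, so the bound for `E` does not pass to its
  -- upper envelope directly; comparison supplies it.
  have hSsup : ∀ z ∈ Ω, upperEnvelope Ω E z ≤ φsup z := hcmp hSsub hsup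
    (fun ζ hζ => (upperEnvelope_upperEnvelope_le ζ).trans (hupp hEsup ζ hζ)) (hlow hle)
  have hES : ∀ z ∈ Ω, v₀ z ≤ upperEnvelope Ω E z := fun z hz =>
    (hv₀E z hz).trans (le_upperEnvelope hz)
  have hSE : ∀ z ∈ Ω, upperEnvelope Ω E z = E z := fun z hz => le_antisymm
    (le_perronEnvelope hΩ_open hSsub
      (fun z hz => ⟨(hv₀b z hz).1.trans (hES z hz), hSM z hz⟩)
      (fun z hz => ⟨(hv₀le z hz).1.trans (hES z hz), hSsup z hz⟩) z hz) (le_upperEnvelope hz)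
  have hEsub : IsViscositySubsolution 𝒞 G f Ω E := hSsub.congr hΩ_open hSE
  have hEb : ∀ z ∈ Ω, (m : EReal) ≤ E z ∧ E z ≤ M := fun z hz =>
    ⟨(hv₀b z hz).1.trans (hv₀E z hz), hEM z hz⟩
  have hEle : ∀ z ∈ Ω, φsub z ≤ E z ∧ E z ≤ φsup z := fun z hz =>
    ⟨(hv₀le z hz).1.trans (hv₀E z hz), hEsup z hz⟩
  -- it coincides with its lower semicontinuous envelope
  have hIsup := isViscositySupersolution_lowerEnvelope_perronEnvelope hn hG hΩ_open hΩne hfΩ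
    hf_bdry hsup hEsub hEb hEle
  have hElow : ∀ ζ ∈ frontier Ω, (φ ζ : EReal) ≤ lowerEnvelope Ω E ζ :=
    hlow fun z hz => (hEle z hz).1
  have hEI : ∀ z ∈ Ω, E z ≤ lowerEnvelope Ω E z := hcmp hEsub hIsup (hupp hEsup)
    fun ζ hζ => (hElow ζ hζ).trans (le_lowerEnvelope_lowerEnvelope ζ)
  have hEsuper : IsViscositySupersolution 𝒞 G f Ω E :=
    hIsup.congr hΩ_open fun z hz => le_antisymm (lowerEnvelope_le hz) (hEI z hz)
  have hcoe : ∀ z ∈ Ω, ((E z).toReal : EReal) = E z := fun z hz => coe_toReal_of_bounds (hEb z hz)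
  refine ⟨fun z => (E z).toReal, hcoe, ⟨hEsub.congr hΩ_open fun z hz => (hcoe z hz).symm,
    hEsuper.congr hΩ_open fun z hz => (hcoe z hz).symm⟩, fun ζ hζ => ?_, fun w hw hwφ z hz => ?_⟩
  · refine tendsto_order.2 ⟨fun a ha => ?_, fun a ha => ?_⟩
    · filter_upwards [eventually_lt_of_lt_lowerEnvelope
        ((EReal.coe_lt_coe_iff.2 ha).trans_le (hElow ζ hζ)), self_mem_nhdsWithin] with y hy hyΩ
      rwa [← hcoe y hyΩ, EReal.coe_lt_coe_iff] at hy
    · filter_upwards [eventually_lt_of_upperEnvelope_lt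
        ((hupp hEsup ζ hζ).trans_lt (EReal.coe_lt_coe_iff.2 ha)), self_mem_nhdsWithin]
        with y hy hyΩ
      rwa [← hcoe y hyΩ, EReal.coe_lt_coe_iff] at hy
  · have h1 := hcmp hw.1 hEsuper (fun ζ hζ => (envelopes_of_tendsto (hwφ ζ hζ)).1) hElow z hz
    have h2 := hcmp hEsub hw.2 (hupp hEsup) (fun ζ hζ => (envelopes_of_tendsto (hwφ ζ hζ)).2) z hz
    rw [← EReal.coe_eq_coe_iff, hcoe z hz]
    exact le_antisymm h1 h2
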